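/- Let $N\ge 2$ be an integer, let $\mathbb T=\{z\in\mathbb C:|z|=1\}$ carry normalized Lebesgue measure $\mu$, and let $BS(1,N)=\langle u,t\mid utu^{-1}=t^N\rangle$. Let $$\mathcal S_N=\{(z_n)_{n\ge0}\mid z_n\in\mathbb T,\ z_{n+1}^N=z_n\}$$ be the solenoid with its Borel $\sigma$-algebra and the shift $S(z_0,z_1,\dots)=(z_0^N,z_0,z_1,\dots)$, a bijection. For a measure $\nu$ on $\mathcal S_N$ write $(\nu\circ S)(E)=\nu(S(E))$. A function $f$ on $\mathbb T$ is regarded as the function $z\mapsto f(z_0)$ on $\mathcal S_N$. Inner products are linear in the first variable. *Wavelet representations.* Let $\rho$ be a unitary representation of $BS(1,N)$ on a Hilbert space $H$, and put $U=\rho(u)$, $T=\rho(t)$. A correlation function of $v,w\in H$ is an $h_{v,w}\in L^1(\mathbb T)$ with $\langle T^kv,w\rangle=\int_{\mathbb T}z^kh_{v,w}\,d\mu$ for all $k\in\mathbb Z$. If every pair of vectors has one (that is, if the spectral measure of $T$ is absolutely continuous with respect to $\mu$), then for $f\in L^\infty(\mathbb T)$ the operator $\pi(f)=f(T)$ of the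 Borel functional calculus is given by $\langle\pi(f)v,w\rangle=\int_{\mathbb T} f\,h_{v,w}\,d\mu$. For $m_0\in L^\infty(\mathbb T)$ and $h\in L^1(\mathbb T)$, a wavelet representation associated to $m_0$ and $h$ is a pair $(\rho,\varphi)$ of a unitary representation $\rho$ of $BS(1,N)$ with this absolute continuity and a vector $\varphi\in H$ that is cyclic for $\rho$, with $U\varphi=\pi(m_0)\varphi$ and $h_{\varphi,\varphi}=h$. *The measure.* Let $m_0\in L^\infty(\mathbb T)$ be non-singular (i.e. $m_0\ne0$ almost everywhere) with $R_{m_0}1=1$ almost everywhere, where $R_{m_0}f(z)=\frac1N\sum_{w^N=z}|m_0(w)|^2f(w)$. Put $W=|m_0|^2/N$ and $\theta=m_0/|m_0|$, write $W(x)=W(e^{-2\pi i x})$ for $x\in[0,1)$, and let $\tau_k(x)=(x+k)/N$ for $0\le k<N$. For almost every $x\in[0,1)$ let $P_x$ be the probability measure on $\Omega=\{0,\dots,N-1\}^{\mathbb N}$ with $$P_x(\{\omega\mid\omega_1=a_1,\dots,\omega_n=a_n\})=W(\tau_{a_1}x)\,W(\tau_{a_2}\tau_{a_1}x)\cdots W(\tau_{a_n}\cdots\tau_{a_1}x)$$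 for all $n\ge 0$ and $a_1,\dots,a_n\in\{0,\dots,N-1\}$, let $\Phi(x,\omega)=(e^{-2\pi ix},e^{-2\pi i\tau_{\omega_1}x},e^{-2\pi i\tau_{\omega_2}\tau_{\omega_1}x},\dots)\in\mathcal S_N$, and let $m$ be the measure on $\mathcal S_N$ with $$m(E)=\int_0^1P_x(\{\omega\mid\Phi(x,\omega)\in E\})\,dx\qquad(E\text{ Borel}).$$ **Theorem.** The measures $P_x$ exist for almost every $x$, and $m$ is a well-defined probability measure. The measures $m\circ S$ and $m$ are mutually absolutely continuous, and with $\Delta=d(m\circ S)/dm$ there is a unitary representation $\rho$ of $BS(1,N)$ on $L^2(\mathcal S_N,m)$ such that $$U\xi=\sqrt{\Delta}\,\theta\,(\xi\circ S)=m_0\,(\xi\circ S),\qquad (T\xi)(z)=z_0\,\xi(z)\qquad(\xi\in L^2(m)).$$ For every $f\in L^\infty(\mathbb T)$, $\pi(f)=f(T)$ is the multiplication operator $\xi\mapsto f\xi$. With $\varphi=1$, $(\rho,\varphi)$ is the wavelet representation associated to $m_0$ and $h=1$: it is such a wavelet representation, and for every wavelet representation $(\rho',\varphi')$ associated to $m_0$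 and $h=1$ on a Hilbert space $H'$ there is a unitary operator from $H'$ onto $L^2(\mathcal S_N,m)$ that intertwines $\rho'$ and $\rho$ and maps $\varphi'$ to $1$. The commutant of $\rho$ in $B(L^2(\mathcal S_N,m))$ is $$\{M_f\mid f\in L^\infty(m),\ f\circ S=f\ m\text{-a.e.}\},\qquad M_f\xi=f\xi.$$ -/

import Mathlib

open MeasureTheory ProbabilityTheory
open scoped ENNReal

noncomputable section

/-! ## The circle with its normalized Lebesgue measure, and the Ruelle operator -/

instance Circle.instMeasurableSpaceBorel : MeasurableSpace Circle := borel Circle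

instance Circle.instBorelSpaceBorel : BorelSpace Circle := ⟨rfl⟩

/-- The parametrization `x ↦ e^{-2πix}` of the circle. -/
def circleParam (x : ℝ) : Circle := Circle.exp (-(2 * Real.pi * x))

/-- Normalized Lebesgue measure on the circle: the image of `dx` on `[0,1)`. -/
def circleMeasure : Measure Circle :=
  ((volume : Measure ℝ).restrict (Set.Ico 0 1)).map circleParam

/-- The Ruelle operator `R f(z) = (1/N) ∑_{w^N = z} |m₀(w)|² f(w)`. -/
def ruelle (N : ℕ) (m₀ f : Circle → ℂ) (z : Circle) : ℂ :=
  (1 / (N : ℂ)) * ∑ᶠ w ∈ {w : Circle | w ^ N = z}, ((‖m₀ w‖ ^ 2 : ℝ) : ℂ) * f w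

/-! ## The Baumslag-Solitar group and its unitary representations -/

/-- `BS(1,N) = ⟨u, t | u t u⁻¹ = t^N⟩`; the generator `0` is `u` and the generator `1` is `t`. -/
abbrev BaumslagSolitar (N : ℕ) : Type :=
  PresentedGroup ({FreeGroup.of 0 * FreeGroup.of 1 * (FreeGroup.of 0)⁻¹ *
    (FreeGroup.of 1 ^ N)⁻¹} : Set (FreeGroup (Fin 2)))

namespace BaumslagSolitar

/-- The generator `u`. -/
def u (N : ℕ) : BaumslagSolitar N := PresentedGroup.of 0

/-- The generator `t`. -/
def t (N : ℕ) : BaumslagSolitar N := PresentedGroup.of 1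

end BaumslagSolitar

section Representations

variable {H : Type*} [NormedAddCommGroup H] [InnerProductSpace ℂ H]

/-- `h ∈ L¹(𝕋)` is the correlation function of `v, w` for the unitary operator `T`:
`⟨T^k v, w⟩ = ∫ z^k h dμ` for all `k ∈ ℤ`. The inner product of the text is linear in the first
variable and that of Mathlib in the second, so that `⟨a, b⟩` is `inner ℂ b a`.
Equivalently, `h dμ` is the complex spectral measure of `T` at `v, w`. -/
structure IsCorrelation (T : H ≃ₗᵢ[ℂ] H) (v w : H) (h : Circle → ℂ) : Prop where
  integrable : Integrable h circleMeasure
  moment : ∀ k : ℤ,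
    inner ℂ w ((T ^ k) v) = ∫ z, (((z ^ k : Circle) : ℂ)) * h z ∂circleMeasure

/-- The spectral measure of the unitary operator `T` is absolutely continuous with respect to
Lebesgue measure: each `⟨E(·)v, w⟩` has an `L¹` density. -/
def HasACSpectrum (T : H ≃ₗᵢ[ℂ] H) : Prop :=
  ∀ v w : H, ∃ h : Circle → ℂ, IsCorrelation T v w h

/-- `A = f(T)` in the Borel functional calculus of a unitary operator with absolutely continuous
spectral measure: `⟨A v, w⟩` is the integral of `f` against the spectral measure of `T` at
`v, w`. -/
def IsBorelCalculus (T : H ≃ₗᵢ[ℂ] H) (f : Circle → ℂ) (A : H →L[ℂ] H) : Prop :=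
  ∀ (v w : H) (h : Circle → ℂ), IsCorrelation T v w h →
    inner ℂ w (A v) = ∫ z, f z * h z ∂circleMeasure

/-- `(H, ρ, φ)` is a wavelet representation of `BS(1,N)` associated to `m₀` and `h`:
`π(f) = f(T)` makes sense for `f ∈ L^∞(𝕋)`, the vector `φ` satisfies the scaling equation
`U φ = π(m₀) φ`, it is cyclic, and its correlation function is `h`. -/
structure IsWaveletRepresentation (N : ℕ) (m₀ h : Circle → ℂ)
    (ρ : BaumslagSolitar N →* (H ≃ₗᵢ[ℂ] H)) (φ : H) : Prop where
  acSpectrum : HasACSpectrum (ρ (BaumslagSolitar.t N))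
  scaling : ∃ A : H →L[ℂ] H,
    IsBorelCalculus (ρ (BaumslagSolitar.t N)) m₀ A ∧ ρ (BaumslagSolitar.u N) φ = A φ
  cyclic : Dense (Submodule.span ℂ (Set.range fun g => ρ g φ) : Set H)
  correlation : IsCorrelation (ρ (BaumslagSolitar.t N)) φ φ h

/-- The commutant of a representation. -/
def commutant {N : ℕ} (ρ : BaumslagSolitar N →* (H ≃ₗᵢ[ℂ] H)) : Set (H →L[ℂ] H) :=
  {A | ∀ g v, A (ρ g v) = ρ g (A v)}

end Representations

/-! ## The solenoid and its shift -/

/-- The solenoid `{(z_n)_{n ≥ 0} | z_{n+1}^N = z_n, |z_n| = 1}` with its product topology and the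
Borel `σ`-algebra. -/
abbrev Solenoid (N : ℕ) : Type := {z : ℕ → Circle // ∀ n, z (n + 1) ^ N = z n}

/-- The shift `S (z_n) = (z_{n-1})`, where `z_{-1} = z_0^N`. Since `z_{n-1} = z_n^N`,
all components of `S z` are given by one formula. -/
def shift (N : ℕ) : Solenoid N ≃ Solenoid N where
  toFun z := ⟨fun n => z.1 n ^ N, fun n => congrArg (· ^ N) (z.2 n)⟩
  invFun z := ⟨fun n => z.1 (n + 1), fun n => z.2 (n + 1)⟩
  left_inv z := Subtype.ext (funext fun n => z.2 n)
  right_inv z := Subtype.ext (funext fun n => z.2 n)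

theorem shift_zero (N : ℕ) (z : Solenoid N) : (shift N z).1 0 = z.1 0 ^ N := rfl

theorem shift_succ (N : ℕ) (z : Solenoid N) (n : ℕ) : (shift N z).1 (n + 1) = z.1 n := z.2 n

/-- The measure `ν ∘ S`, `(ν ∘ S)(E) = ν(S(E))`. -/
def measureCompShift {N : ℕ} (ν : Measure (Solenoid N)) : Measure (Solenoid N) :=
  ν.map (shift N).symm

/-- Multiplication operators: `A` is multiplication by `f` on `L²(ν)`. -/
def IsMultiplication {N : ℕ} {ν : Measure (Solenoid N)} (f : Solenoid N → ℂ)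
    (A : Lp ℂ 2 ν →L[ℂ] Lp ℂ 2 ν) : Prop :=
  ∀ ξ : Lp ℂ 2 ν, A ξ =ᵐ[ν] fun z => f z * ξ z

/-- `ρ` is the representation of `BS(1,N)` on `L²(ν)` associated to `ν` and `θ`, where `ν` is a
`σ`-finite measure that is quasi-invariant for `S`, and `θ` is a measurable function of absolute
value one: `U ξ = √Δ θ (ξ ∘ S)` with `Δ = d(ν ∘ S)/dν`, and `(T ξ)(z) = z_0 ξ(z)`. -/
structure IsSolenoidRepresentation {N : ℕ} (ν : Measure (Solenoid N)) (θ : Solenoid N → ℂ)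
    (ρ : BaumslagSolitar N →* (Lp ℂ 2 ν ≃ₗᵢ[ℂ] Lp ℂ 2 ν)) : Prop where
  sigmaFinite : SigmaFinite ν
  ac : measureCompShift ν ≪ ν
  ac' : ν ≪ measureCompShift ν
  aestronglyMeasurable : AEStronglyMeasurable θ ν
  norm_eq_one : ∀ᵐ z ∂ν, ‖θ z‖ = 1
  u_apply : ∀ ξ : Lp ℂ 2 ν, ρ (BaumslagSolitar.u N) ξ =ᵐ[ν] fun z =>
    ((Real.sqrt ((measureCompShift ν).rnDeriv ν z).toReal : ℝ) : ℂ) * θ z * ξ (shift N z)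
  t_apply : ∀ ξ : Lp ℂ 2 ν, ρ (BaumslagSolitar.t N) ξ =ᵐ[ν] fun z => (z.1 0 : ℂ) * ξ z

/-! ## The random walk and its measure on the solenoid -/

section RandomWalk

variable (N : ℕ)

/-- The inverse branch `τ_k(x) = (x + k)/N` of `x ↦ N x mod 1`. -/
def branch (k : Fin N) (x : ℝ) : ℝ := (x + (k : ℕ)) / N

/-- `τ_{ω_n} ⋯ τ_{ω_1} x`; the sequence `ω_1, ω_2, …` is indexed from `0` here. -/
def walkPos (x : ℝ) (ω : ℕ → Fin N) : ℕ → ℝ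
  | 0 => x
  | n + 1 => branch N (ω n) (walkPos x ω n)

variable [NeZero N]

theorem circleParam_branch (k : Fin N) (x : ℝ) :
    circleParam (branch N k x) ^ N = circleParam x := by
  have hN : (N : ℝ) ≠ 0 := Nat.cast_ne_zero.mpr (NeZero.ne N)
  unfold circleParam branch
  rw [← Circle.exp_natCast_mul]
  have h : (N : ℝ) * (-(2 * Real.pi * ((x + ((k : ℕ) : ℝ)) / N)))
      = -(2 * Real.pi * x) - ((k : ℕ) : ℝ) * (2 * Real.pi) := by
    field_simp
    ring
  rw [h]
  exact (Circle.periodic_exp.sub_nat_mul_eq _)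

/-- The map `Φ(x, ω) = (e^{-2πix}, e^{-2πi τ_{ω_1} x}, e^{-2πi τ_{ω_2} τ_{ω_1} x}, …)`. -/
def solenoidPath (x : ℝ) (ω : ℕ → Fin N) : Solenoid N :=
  ⟨fun n => circleParam (walkPos N x ω n), fun n => circleParam_branch N (ω n) _⟩

open Classical in
/-- The law of one step from `y`: the branch `k` is taken with probability `W(τ_k y)`.
(An arbitrary law is used at points where these numbers are not a probability vector.) -/
def stepLaw (W : Circle → ℝ) (y : ℝ) : Measure (Fin N) :=
  if (∀ k, 0 ≤ W (circleParam (branch N k y))) ∧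
      ∑ k : Fin N, W (circleParam (branch N k y)) = 1 then
    ∑ k : Fin N, ENNReal.ofReal (W (circleParam (branch N k y))) • Measure.dirac k
  else Measure.dirac 0

instance (W : Circle → ℝ) (y : ℝ) : IsProbabilityMeasure (stepLaw N W y) := by
  unfold stepLaw
  split_ifs with h
  · refine ⟨?_⟩
    simp only [Measure.coe_finsetSum, Measure.coe_smul, Finset.sum_apply, Pi.smul_apply,
      measure_univ, smul_eq_mul, mul_one]
    rw [← ENNReal.ofReal_sum_of_nonneg fun k _ => h.1 k, h.2, ENNReal.ofReal_one]
  · infer_instance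

/-- The transition kernel of the walk started at `x`: given the first `n + 1` digits, the next one
is drawn from the step law at the current position. -/
def walkKernel (W : Circle → ℝ) (x : ℝ) (n : ℕ) :
    Kernel (Finset.Iic n → Fin N) (Fin N) :=
  Kernel.ofFunOfCountable fun p => stepLaw N W
    (walkPos N x (fun i => if hi : i ≤ n then p ⟨i, Finset.mem_Iic.mpr hi⟩ else 0) (n + 1))

instance (W : Circle → ℝ) (x : ℝ) (n : ℕ) : IsMarkovKernel (walkKernel N W x n) :=
  ⟨fun _ => inferInstanceAs (IsProbabilityMeasure (stepLaw N W _))⟩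

/-- The measure `P_x` on `Ω = {0, …, N-1}^ℕ`: the law of the digits of the random walk that
starts at `x` and moves from `y` to `τ_k y` with probability `W(τ_k y)`. -/
def walkMeasure (W : Circle → ℝ) (x : ℝ) : Measure (ℕ → Fin N) :=
  Kernel.trajMeasure (X := fun _ => Fin N) (stepLaw N W x) (walkKernel N W x)

instance (W : Circle → ℝ) (x : ℝ) : IsProbabilityMeasure (walkMeasure N W x) :=
  inferInstanceAs (IsProbabilityMeasure (Kernel.trajMeasure (X := fun _ => Fin N)
    (stepLaw N W x) (walkKernel N W x)))

/-- The random-walk measure `m` on the solenoid,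
`∫ f dm = ∫_{[0,1)} ∫_Ω f(Φ(x, ω)) dP_x(ω) dx`. -/
def solenoidMeasure (W : Circle → ℝ) : Measure (Solenoid N) :=
  ((volume : Measure ℝ).restrict (Set.Ico 0 1)).bind
    fun x => (walkMeasure N W x).map (solenoidPath N x)

end RandomWalk

/-- The function `W = |m₀|²/N`. -/
def filterWeight (N : ℕ) (m₀ : Circle → ℂ) (z : Circle) : ℝ := ‖m₀ z‖ ^ 2 / N

theorem measurable_walkPos (N : ℕ) (x : ℝ) (n : ℕ) :
    Measurable fun ω : ℕ → Fin N => walkPos N x ω n := by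
  induction n with
  | zero => exact measurable_const
  | succ n ih =>
    have hk : Measurable fun ω : ℕ → Fin N => (((ω n : Fin N) : ℕ) : ℝ) :=
      (measurable_of_countable fun k : Fin N => ((k : ℕ) : ℝ)).comp (measurable_pi_apply n)
    exact (ih.add hk).div_const _

theorem measurable_solenoidPath (N : ℕ) [NeZero N] (x : ℝ) :
    Measurable (solenoidPath N x) := by
  refine Measurable.subtype_mk (measurable_pi_lambda _ fun n => ?_)
  have hc : Continuous circleParam := by
    unfold circleParam
    fun_prop
  exact hc.measurable.comp (measurable_walkPos N x n)

instance (N : ℕ) [NeZero N] (W : Circle → ℝ) : IsFiniteMeasure (solenoidMeasure N W) := by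
  by_cases hf : AEMeasurable (fun x => (walkMeasure N W x).map (solenoidPath N x))
      ((volume : Measure ℝ).restrict (Set.Ico 0 1))
  · refine ⟨?_⟩
    unfold solenoidMeasure
    rw [Measure.bind_apply MeasurableSet.univ hf]
    have h1 : ∀ x : ℝ, ((walkMeasure N W x).map (solenoidPath N x)) Set.univ = 1 := fun x => by
      have := Measure.isProbabilityMeasure_map (μ := walkMeasure N W x)
        (measurable_solenoidPath N x).aemeasurable
      exact measure_univ
    simp [h1]
  · have h0 : solenoidMeasure N W = 0 := by
      unfold solenoidMeasure Measure.bind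
      rw [Measure.map_of_not_aemeasurable hf, Measure.join_zero]
    rw [h0]
    infer_instance

/-- The random-walk measure on the solenoid associated to `W = |m₀|²/N`. -/
abbrev filterMeasure (N : ℕ) [NeZero N] (m₀ : Circle → ℂ) : Measure (Solenoid N) :=
  solenoidMeasure N (filterWeight N m₀)

/-- The function `θ = m₀/|m₀|` on the circle, as a function of `z_0` on the solenoid. -/
def filterPhase (N : ℕ) (m₀ : Circle → ℂ) (z : Solenoid N) : ℂ :=
  m₀ (z.1 0) / (‖m₀ (z.1 0)‖ : ℂ)

end

/-! Everything rests on the laws of the coordinates under m. One step of the walk integrates a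
function of the position to its Ruelle transform, and this transform is dual to multiplication by
|m₀|² on the circle, so z_n has density ∏_{j<n} |m₀(z^{N^j})|² with respect to μ
(`filterMeasure_map_coord`). Since z_n determines all earlier coordinates, these laws determine a
finite measure on the solenoid (`Solenoid.measure_ext`). Going from n to n + 1 multiplies the
density by |m₀(z_n^{N^n})|² = |m₀(z_0)|², and S⁻¹ moves coordinate n + 1 to coordinate n; hence m ∘
S = |m₀(z_0)|² m (`filterMeasure_map_shift_symm`). So √Δ θ = m₀(z_0), non-singularity makes the two
measures equivalent, and ξ ↦ m₀ · (ξ ∘ S) is unitary (`exists_linearIsometryEquiv_mul_comp`).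

The element u⁻ⁿ t^k uⁿ acts as multiplication by the character z_n^k (`conj_apply_ae_eq`). By
Stone-Weierstrass these characters span a dense subspace of L²(m). This gives cyclicity of 1, and it
shows that an operator A in the commutant is multiplication by A1; commuting with U then says that
A1 is S-invariant (`commutant_eq_mul`).

Uniqueness is a Gelfand-Naimark-Segal argument. Every group element is a word u⁻ⁿ t^k u^m
(`BaumslagSolitar.exists_eq_word`). As h = 1, the vectors T^k φ span a copy of L²(𝕋), on which U
acts as f ↦ m₀ f(z^N) (`IsWaveletRepresentation.u_apply_linearIsometry`). The coefficients of the
representation at φ are therefore inner products in L²(𝕋) that depend on m₀ alone, and equal Gram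
matrices of the two orbits yield the intertwining unitary
(`IsWaveletRepresentation.exists_intertwiner`). -/

noncomputable section

/-! ## Isometries determined by Gram matrices -/

section Gram

variable {ι E F : Type*} [NormedAddCommGroup E] [InnerProductSpace ℂ E]
  [NormedAddCommGroup F] [InnerProductSpace ℂ F] {v : ι → E} {w : ι → F}

theorem norm_linearCombination_eq_of_inner_eq
    (h : ∀ i j, inner ℂ (v i) (v j) = inner ℂ (w i) (w j)) (c : ι →₀ ℂ) :
    ‖Finsupp.linearCombination ℂ w c‖ = ‖Finsupp.linearCombination ℂ v c‖ := by
  have key : inner ℂ (Finsupp.linearCombination ℂ w c) (Finsupp.linearCombination ℂ w c) =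
      inner ℂ (Finsupp.linearCombination ℂ v c) (Finsupp.linearCombination ℂ v c) := by
    simp only [Finsupp.linearCombination_apply, inner_smul_left, inner_smul_right,
      Finsupp.sum, inner_sum, sum_inner, h]
  rw [inner_self_eq_norm_sq_to_K, inner_self_eq_norm_sq_to_K] at key
  have : ‖Finsupp.linearCombination ℂ w c‖ ^ 2 = ‖Finsupp.linearCombination ℂ v c‖ ^ 2 := by
    exact_mod_cast key
  exact (sq_eq_sq₀ (norm_nonneg _) (norm_nonneg _)).1 this

/-- Norms of linear combinations can be read off the Gram matrix, so v i ↦ w i is well defined and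
isometric on the span; it extends by density. -/
theorem exists_linearIsometry_of_inner_eq [CompleteSpace F]
    (hv : Dense (Submodule.span ℂ (Set.range v) : Set E))
    (h : ∀ i j, inner ℂ (v i) (v j) = inner ℂ (w i) (w j)) :
    ∃ V : E →ₗᵢ[ℂ] F, ∀ i, V (v i) = w i := by
  set e := Finsupp.linearCombination ℂ v
  set f := Finsupp.linearCombination ℂ w
  have he : DenseRange e := by
    rw [← Finsupp.range_linearCombination] at hv
    exact hv
  have hn : ∀ c, ‖f c‖ = ‖e c‖ := norm_linearCombination_eq_of_inner_eq h
  have heq : ∀ c, f.extendOfNorm e (e c) = f c :=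
    LinearMap.extendOfNorm_eq he ⟨1, fun c => by rw [hn c, one_mul]⟩
  refine ⟨⟨(f.extendOfNorm e : E →ₗ[ℂ] F), fun x => ?_⟩, fun i => ?_⟩
  · refine he.induction (P := fun x => ‖f.extendOfNorm e x‖ = ‖x‖) ?_
      (isClosed_eq (by fun_prop) continuous_norm) x
    rintro _ ⟨c, rfl⟩
    rw [heq, hn]
  · have := heq (Finsupp.single i 1)
    simpa [e, f] using this

theorem exists_linearIsometryEquiv_of_inner_eq [CompleteSpace E] [CompleteSpace F]
    (hv : Dense (Submodule.span ℂ (Set.range v) : Set E))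
    (hw : Dense (Submodule.span ℂ (Set.range w) : Set F))
    (h : ∀ i j, inner ℂ (v i) (v j) = inner ℂ (w i) (w j)) :
    ∃ V : E ≃ₗᵢ[ℂ] F, ∀ i, V (v i) = w i := by
  obtain ⟨V, hV⟩ := exists_linearIsometry_of_inner_eq hv h
  -- An isometry from a complete space has closed range, and this range contains the dense span of
  -- `w`.
  have hcl : IsClosed (Set.range V) := V.isometry.isClosedEmbedding.isClosed_range
  have hsub : (Submodule.span ℂ (Set.range w) : Set F) ⊆ Set.range V := by
    have : Submodule.span ℂ (Set.range w) ≤ LinearMap.range V.toLinearMap :=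
      Submodule.span_le.2 (by rintro _ ⟨i, rfl⟩; exact ⟨v i, hV i⟩)
    exact this
  have hsurj : Function.Surjective V := by
    rw [← Set.range_eq_univ, ← hcl.closure_eq]
    exact (hw.mono hsub).closure_eq
  exact ⟨LinearIsometryEquiv.ofSurjective V hsurj, hV⟩

end Gram

/-! ## Integrals against characters -/

section Characters

/-- Indicators of closed sets are bounded pointwise limits of continuous functions, so dominated
convergence makes the integral of `d` over every closed set vanish, and these integrals determine
`d`. -/
theorem ae_eq_zero_of_integral_continuous_mul_eq_zero {X : Type*} [TopologicalSpace X]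
    [MeasurableSpace X] [BorelSpace X] [HasOuterApproxClosed X] (ν : Measure X) {d : X → ℂ}
    (hd : Integrable d ν) (h : ∀ g : C(X, ℂ), ∫ x, g x * d x ∂ν = 0) : d =ᵐ[ν] 0 := by
  refine ae_eq_zero_of_forall_setIntegral_isClosed_eq_zero hd fun s hs => ?_
  rw [← integral_indicator hs.measurableSet]
  have hlim : Filter.Tendsto (fun n : ℕ => ∫ x, ((hs.apprSeq n x : ℝ) : ℂ) * d x ∂ν) Filter.atTop
      (nhds (∫ x, s.indicator d x ∂ν)) := by
    refine tendsto_integral_of_dominated_convergence (fun x => ‖d x‖) (fun n => ?_) hd.norm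
      (fun n => ?_) ?_
    · refine AEStronglyMeasurable.mul ?_ hd.1
      exact Continuous.aestronglyMeasurable (by fun_prop)
    · refine Filter.Eventually.of_forall fun x => ?_
      rw [norm_mul]
      have : ‖((hs.apprSeq n x : ℝ) : ℂ)‖ ≤ 1 := by
        simpa using HasOuterApproxClosed.apprSeq_apply_le_one hs n x
      exact mul_le_of_le_one_left (norm_nonneg _) this
    · refine Filter.Eventually.of_forall fun x => ?_
      have h1 := (tendsto_pi_nhds.1 (HasOuterApproxClosed.tendsto_apprSeq hs)) x
      have h2 : s.indicator d x = (((s.indicator (fun _ => (1 : NNReal)) x : NNReal) : ℝ) : ℂ) * d x := by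
        by_cases hx : x ∈ s <;> simp [hx]
      rw [h2]
      refine Filter.Tendsto.mul_const _ ?_
      have hc : Continuous fun r : NNReal => ((r : ℝ) : ℂ) := by fun_prop
      exact (hc.tendsto _).comp h1
  refine tendsto_nhds_unique hlim ?_
  have : ∀ n : ℕ, ∫ x, ((hs.apprSeq n x : ℝ) : ℂ) * d x ∂ν = 0 := fun n =>
    h ⟨fun x => ((hs.apprSeq n x : ℝ) : ℂ), by fun_prop⟩
  simp only [this]
  exact tendsto_const_nhds

variable {X ι : Type*} [TopologicalSpace X] [CompactSpace X] {χ : ι → C(X, ℂ)}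

/-- A family of functions that is closed under products and conjugation, contains `1` and separates
points spans a dense subspace of `C(X)`. -/
theorem dense_span_of_characters (hone : ∃ i, χ i = 1) (hmul : ∀ i j, ∃ k, χ k = χ i * χ j)
    (hstar : ∀ i, ∃ j, χ j = star (χ i)) (hsep : ∀ x y, x ≠ y → ∃ i, χ i x ≠ χ i y) :
    Dense (Submodule.span ℂ (Set.range χ) : Set C(X, ℂ)) := by
  let M : Submonoid C(X, ℂ) :=
    { carrier := Set.range χ
      one_mem' := hone
      mul_mem' := by
        rintro _ _ ⟨i, rfl⟩ ⟨j, rfl⟩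
        exact hmul i j }
  -- The family is already a multiplicative monoid, so the algebra it generates is its linear span;
  -- Stone-Weierstrass then applies to the span.
  have hspan : (Algebra.adjoin ℂ (Set.range χ) : Subalgebra ℂ C(X, ℂ)).toSubmodule =
      Submodule.span ℂ (Set.range χ) := by
    rw [Algebra.adjoin_eq_span]
    congr 1
    exact congrArg SetLike.coe (Submonoid.closure_eq M)
  have hmem : ∀ a ∈ Algebra.adjoin ℂ (Set.range χ), star a ∈ Algebra.adjoin ℂ (Set.range χ) := by
    intro a ha
    have hstars : Set.range χ ⊆ star (Set.range χ) := by
      rintro _ ⟨i, rfl⟩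
      obtain ⟨j, hj⟩ := hstar i
      exact ⟨j, hj⟩
    have h1 := Algebra.adjoin_mono (R := ℂ) hstars ha
    rw [← Subalgebra.star_adjoin_comm] at h1
    exact h1
  let A : StarSubalgebra ℂ C(X, ℂ) :=
    { Algebra.adjoin ℂ (Set.range χ) with star_mem' := fun {a} ha => hmem a ha }
  have hA : A.SeparatesPoints := by
    intro x y hxy
    obtain ⟨i, hi⟩ := hsep x y hxy
    exact ⟨χ i, ⟨χ i, Algebra.subset_adjoin ⟨i, rfl⟩, rfl⟩, hi⟩
  have htop := ContinuousMap.starSubalgebra_topologicalClosure_eq_top_of_separatesPoints A hA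
  have hd : Dense (A : Set C(X, ℂ)) := by
    rw [dense_iff_closure_eq, ← StarSubalgebra.topologicalClosure_coe, htop]
    rfl
  rw [← hspan]
  exact hd

variable [MeasurableSpace X] [BorelSpace X] (ν : Measure X)

theorem dense_span_toLp_of_characters [NormalSpace X] [IsFiniteMeasure ν] [ν.WeaklyRegular]
    (hone : ∃ i, χ i = 1) (hmul : ∀ i j, ∃ k, χ k = χ i * χ j)
    (hstar : ∀ i, ∃ j, χ j = star (χ i)) (hsep : ∀ x y, x ≠ y → ∃ i, χ i x ≠ χ i y) :
    Dense (Submodule.span ℂ (Set.range fun i => ContinuousMap.toLp 2 ν ℂ (χ i)) :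
      Set (Lp ℂ 2 ν)) := by
  have h1 := (ContinuousMap.toLp_denseRange (p := 2) ℂ ν ℂ (by norm_num)).dense_image
    (ContinuousLinearMap.continuous _) (dense_span_of_characters hone hmul hstar hsep)
  have h2 : (Set.range fun i => ContinuousMap.toLp 2 ν ℂ (χ i)) =
      (ContinuousMap.toLp 2 ν ℂ : C(X, ℂ) →L[ℂ] Lp ℂ 2 ν) '' Set.range χ := by
    rw [← Set.range_comp]
    rfl
  rw [h2]
  have h3 := Submodule.map_span
    ((ContinuousMap.toLp 2 ν ℂ : C(X, ℂ) →L[ℂ] Lp ℂ 2 ν) : C(X, ℂ) →ₗ[ℂ] Lp ℂ 2 ν) (Set.range χ)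
  have h4 : ((Submodule.map ((ContinuousMap.toLp 2 ν ℂ : C(X, ℂ) →L[ℂ] Lp ℂ 2 ν) :
      C(X, ℂ) →ₗ[ℂ] Lp ℂ 2 ν) (Submodule.span ℂ (Set.range χ)) : Submodule ℂ (Lp ℂ 2 ν)) :
      Set (Lp ℂ 2 ν)) = (ContinuousMap.toLp 2 ν ℂ : C(X, ℂ) →L[ℂ] Lp ℂ 2 ν) ''
        (Submodule.span ℂ (Set.range χ) : Set C(X, ℂ)) := Submodule.map_coe _ _
  rw [h3] at h4
  exact h4 ▸ h1

/-- Integration against `d` is a sup-norm continuous functional on C(X) that vanishes on a dense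
span, hence everywhere. -/
theorem ae_eq_zero_of_integral_characters_mul_eq_zero [HasOuterApproxClosed X]
    (hone : ∃ i, χ i = 1) (hmul : ∀ i j, ∃ k, χ k = χ i * χ j)
    (hstar : ∀ i, ∃ j, χ j = star (χ i)) (hsep : ∀ x y, x ≠ y → ∃ i, χ i x ≠ χ i y)
    {d : X → ℂ} (hd : Integrable d ν) (h : ∀ i, ∫ x, χ i x * d x ∂ν = 0) : d =ᵐ[ν] 0 := by
  refine ae_eq_zero_of_integral_continuous_mul_eq_zero ν hd fun g => ?_
  have hint : ∀ g : C(X, ℂ), Integrable (fun x => g x * d x) ν := fun g =>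
    hd.bdd_mul g.continuous.aestronglyMeasurable
      (Filter.Eventually.of_forall fun x => g.norm_coe_le_norm x)
  let L : C(X, ℂ) →L[ℂ] ℂ := LinearMap.mkContinuous
    { toFun := fun g => ∫ x, g x * d x ∂ν
      map_add' := fun g₁ g₂ => by
        simp only [ContinuousMap.add_apply, add_mul]
        exact integral_add (hint g₁) (hint g₂)
      map_smul' := fun c g => by
        simp only [ContinuousMap.smul_apply, smul_eq_mul, mul_assoc, RingHom.id_apply]
        exact integral_const_mul c _ } (∫ x, ‖d x‖ ∂ν) (fun g => by
      refine (norm_integral_le_integral_norm _).trans ?_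
      rw [mul_comm, ← integral_const_mul]
      refine integral_mono (hint g).norm (hd.norm.const_mul _) fun x => ?_
      simp only [norm_mul]
      exact mul_le_mul_of_nonneg_right (g.norm_coe_le_norm x) (norm_nonneg _))
  have hL : L = 0 := by
    refine ContinuousLinearMap.ext_on (s := Set.range χ)
      (dense_span_of_characters hone hmul hstar hsep) ?_
    rintro _ ⟨i, rfl⟩
    exact h i
  exact congrArg (fun l : C(X, ℂ) →L[ℂ] ℂ => l g) hL

end Characters

/-! ## Weighted composition operators -/

section WeightedComposition

variable {X Y : Type*} [MeasurableSpace X] [MeasurableSpace Y] {ν : Measure X} {ν' : Measure Y}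

theorem eLpNorm_two_eq_rpow_lintegral (f : X → ℂ) :
    eLpNorm f 2 ν = (∫⁻ x, ‖f x‖ₑ ^ 2 ∂ν) ^ (1 / 2 : ℝ) := by
  rw [eLpNorm_eq_lintegral_rpow_enorm_toReal (by norm_num) (by norm_num)]
  simp

variable {p : X → Y} {c : X → ℂ}

/-- As c ≠ 0 almost everywhere, ν and |c|²ν have the same null sets. This makes composition with `p`
meaningful on almost-everywhere classes. -/
theorem quasiMeasurePreserving_of_map_withDensity (hp : Measurable p)
    (hc : AEStronglyMeasurable c ν) (hc0 : ∀ᵐ x ∂ν, c x ≠ 0)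
    (h : (ν.withDensity fun x => ‖c x‖ₑ ^ 2).map p = ν') :
    Measure.QuasiMeasurePreserving p ν ν' := by
  refine ⟨hp, ?_⟩
  rw [← h]
  refine Measure.AbsolutelyContinuous.map (withDensity_absolutelyContinuous' ?_ ?_) hp
  · exact hc.enorm.pow_const 2
  · filter_upwards [hc0] with x hx
    simpa using hx

theorem lintegral_enorm_sq_mul_comp (hp : Measurable p) (hc : AEStronglyMeasurable c ν)
    (hc0 : ∀ᵐ x ∂ν, c x ≠ 0) (h : (ν.withDensity fun x => ‖c x‖ₑ ^ 2).map p = ν')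
    {g : Y → ℝ≥0∞} (hg : AEMeasurable g ν') :
    ∫⁻ x, ‖c x‖ₑ ^ 2 * g (p x) ∂ν = ∫⁻ y, g y ∂ν' := by
  have hq := quasiMeasurePreserving_of_map_withDensity hp hc hc0 h
  have hg' := hg
  rw [← h] at hg'
  rw [← h, lintegral_map' hg' hp.aemeasurable,
    lintegral_withDensity_eq_lintegral_mul₀ (hc.enorm.pow_const 2)
      (f := fun x => ‖c x‖ₑ ^ 2) (g := fun x => g (p x)) (hg.comp_quasiMeasurePreserving hq)]
  rfl

theorem eLpNorm_mul_comp (hp : Measurable p) (hc : AEStronglyMeasurable c ν)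
    (hc0 : ∀ᵐ x ∂ν, c x ≠ 0) (h : (ν.withDensity fun x => ‖c x‖ₑ ^ 2).map p = ν')
    {ξ : Y → ℂ} (hξ : AEStronglyMeasurable ξ ν') :
    eLpNorm (fun x => c x * ξ (p x)) 2 ν = eLpNorm ξ 2 ν' := by
  rw [eLpNorm_two_eq_rpow_lintegral, eLpNorm_two_eq_rpow_lintegral,
    ← lintegral_enorm_sq_mul_comp hp hc hc0 h (hξ.enorm.pow_const 2)]
  simp only [enorm_mul, mul_pow]

theorem exists_linearIsometry_mul_comp (hp : Measurable p) (hc : AEStronglyMeasurable c ν)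
    (hc0 : ∀ᵐ x ∂ν, c x ≠ 0) (h : (ν.withDensity fun x => ‖c x‖ₑ ^ 2).map p = ν') :
    ∃ V : Lp ℂ 2 ν' →ₗᵢ[ℂ] Lp ℂ 2 ν, ∀ ξ, V ξ =ᵐ[ν] fun x => c x * ξ (p x) := by
  have hq := quasiMeasurePreserving_of_map_withDensity hp hc hc0 h
  have hmem : ∀ ξ : Lp ℂ 2 ν', MemLp (fun x => c x * ξ (p x)) 2 ν := fun ξ =>
    ⟨hc.mul ((Lp.aestronglyMeasurable ξ).comp_quasiMeasurePreserving hq), by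
      rw [eLpNorm_mul_comp hp hc hc0 h (Lp.aestronglyMeasurable ξ)]
      exact Lp.eLpNorm_lt_top ξ⟩
  refine ⟨⟨{ toFun := fun ξ => (hmem ξ).toLp
             map_add' := fun ξ η => ?_
             map_smul' := fun a ξ => ?_ }, fun ξ => ?_⟩, fun ξ => (hmem ξ).coeFn_toLp⟩
  · refine Lp.ext ?_
    filter_upwards [(hmem (ξ + η)).coeFn_toLp, Lp.coeFn_add (hmem ξ).toLp (hmem η).toLp,
      (hmem ξ).coeFn_toLp, (hmem η).coeFn_toLp, hq.ae (Lp.coeFn_add ξ η)] with x h1 h2 h3 h4 h5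
    rw [h1, h2, Pi.add_apply, h3, h4, h5, Pi.add_apply, mul_add]
  · refine Lp.ext ?_
    filter_upwards [(hmem (a • ξ)).coeFn_toLp, Lp.coeFn_smul a (hmem ξ).toLp,
      (hmem ξ).coeFn_toLp, hq.ae (Lp.coeFn_smul a ξ)] with x h1 h2 h3 h5
    rw [h1, RingHom.id_apply, h2, Pi.smul_apply, h3, h5, Pi.smul_apply, smul_eq_mul, smul_eq_mul,
      mul_left_comm]
  · change ‖(hmem ξ).toLp‖ = ‖ξ‖
    rw [Lp.norm_toLp, eLpNorm_mul_comp hp hc hc0 h (Lp.aestronglyMeasurable ξ), Lp.norm_def]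

/-- The weight |c|² compensates the change of measure under S, which gives an isometry. It is onto
because η has the preimage (η / c) ∘ S⁻¹; the hypothesis also makes S⁻¹ preserve null sets, so this
function is measurable up to a null set. -/
theorem exists_linearIsometryEquiv_mul_comp (S : X ≃ᵐ X) (hc : AEStronglyMeasurable c ν)
    (hc0 : ∀ᵐ x ∂ν, c x ≠ 0) (h : ν.map S.symm = ν.withDensity fun x => ‖c x‖ₑ ^ 2) :
    ∃ V : Lp ℂ 2 ν ≃ₗᵢ[ℂ] Lp ℂ 2 ν, ∀ ξ, V ξ =ᵐ[ν] fun x => c x * ξ (S x) := by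
  have h' : (ν.withDensity fun x => ‖c x‖ₑ ^ 2).map S = ν := by
    rw [← h, Measure.map_map S.measurable S.symm.measurable]
    simp
  have hq := quasiMeasurePreserving_of_map_withDensity S.measurable hc hc0 h'
  have hqs : Measure.QuasiMeasurePreserving S.symm ν ν :=
    ⟨S.symm.measurable, by rw [h]; exact withDensity_absolutelyContinuous _ _⟩
  obtain ⟨V, hV⟩ := exists_linearIsometry_mul_comp S.measurable hc hc0 h'
  refine ⟨LinearIsometryEquiv.ofSurjective V fun η => ?_, hV⟩
  have hmeas : AEStronglyMeasurable (fun x => η (S.symm x) / c (S.symm x)) ν :=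
    ((Lp.aestronglyMeasurable η).aemeasurable.div
      hc.aemeasurable).aestronglyMeasurable.comp_quasiMeasurePreserving hqs
  have hae : (fun x => c x * ((fun x => η (S.symm x) / c (S.symm x)) (S x))) =ᵐ[ν] η := by
    filter_upwards [hc0] with x hx
    simp only [MeasurableEquiv.symm_apply_apply]
    rw [mul_div_cancel₀ _ hx]
  have hmem : MemLp (fun x => η (S.symm x) / c (S.symm x)) 2 ν := by
    refine ⟨hmeas, ?_⟩
    rw [← eLpNorm_mul_comp S.measurable hc hc0 h' hmeas, eLpNorm_congr_ae hae]
    exact Lp.eLpNorm_lt_top η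
  refine ⟨hmem.toLp, Lp.ext ((hV _).trans (Filter.EventuallyEq.trans ?_ hae))⟩
  filter_upwards [hq.ae hmem.coeFn_toLp] with x hx
  rw [hx]

end WeightedComposition

/-! ## Multiplication operators -/

section Multiplication

variable {X : Type*} [MeasurableSpace X] {ν : Measure X}

theorem exists_continuousLinearMap_mul {f : X → ℂ} (hf : MemLp f ∞ ν) :
    ∃ A : Lp ℂ 2 ν →L[ℂ] Lp ℂ 2 ν, ∀ ξ, A ξ =ᵐ[ν] fun x => f x * ξ x := by
  refine ⟨LinearMap.mkContinuous
    { toFun := fun ξ => (hf.toLp • ξ : Lp ℂ 2 ν)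
      map_add' := fun ξ η => Lp.add_smul _ _ _
      map_smul' := fun a ξ => ?_ } ‖hf.toLp‖ (fun ξ => Lp.norm_smul_le _ _), fun ξ => ?_⟩
  · refine Lp.ext ?_
    filter_upwards [Lp.coeFn_lpSMul (r := 2) hf.toLp (a • ξ),
      Lp.coeFn_smul a (hf.toLp • ξ : Lp ℂ 2 ν), Lp.coeFn_lpSMul (r := 2) hf.toLp ξ,
      Lp.coeFn_smul a ξ] with x h1 h2 h3 h4
    rw [h1, RingHom.id_apply, h2, Pi.smul_apply, h3, Pi.smul_apply', h4, Pi.smul_apply,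
      Pi.smul_apply', smul_comm]
  · change (hf.toLp • ξ : Lp ℂ 2 ν) =ᵐ[ν] _
    filter_upwards [Lp.coeFn_lpSMul (r := 2) hf.toLp ξ, hf.coeFn_toLp] with x h1 h2
    rw [h1, Pi.smul_apply', h2, smul_eq_mul]

theorem Lp.exists_subseq_tendsto_ae {ξ : ℕ → Lp ℂ 2 ν} {η : Lp ℂ 2 ν}
    (h : Filter.Tendsto ξ Filter.atTop (nhds η)) :
    ∃ k : ℕ → ℕ, StrictMono k ∧
      ∀ᵐ x ∂ν, Filter.Tendsto (fun n => ξ (k n) x) Filter.atTop (nhds (η x)) :=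
  (tendstoInMeasure_of_tendsto_Lp h).exists_seq_tendsto_ae

/-- An operator that acts as multiplication by `F` on a total set is multiplication by `F`. -/
theorem ae_eq_mul_of_dense_span (A : Lp ℂ 2 ν →L[ℂ] Lp ℂ 2 ν) (F : X → ℂ) {s : Set (Lp ℂ 2 ν)}
    (hs : Dense (Submodule.span ℂ s : Set (Lp ℂ 2 ν)))
    (h : ∀ ξ ∈ s, A ξ =ᵐ[ν] fun x => F x * ξ x) (ξ : Lp ℂ 2 ν) :
    A ξ =ᵐ[ν] fun x => F x * ξ x := by
  have hspan : ∀ ξ ∈ Submodule.span ℂ s, A ξ =ᵐ[ν] fun x => F x * ξ x := by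
    intro ξ hξ
    induction hξ using Submodule.span_induction with
    | mem ξ hξ => exact h ξ hξ
    | zero =>
      rw [map_zero]
      filter_upwards [Lp.coeFn_zero ℂ 2 ν] with x hx
      rw [hx, Pi.zero_apply, mul_zero]
    | add ξ η _ _ h1 h2 =>
      rw [map_add]
      filter_upwards [Lp.coeFn_add (A ξ) (A η), Lp.coeFn_add ξ η, h1, h2] with x e1 e2 e3 e4
      rw [e1, e2, Pi.add_apply, Pi.add_apply, e3, e4, mul_add]
    | smul a ξ _ h1 =>
      rw [map_smul]
      filter_upwards [Lp.coeFn_smul a (A ξ), Lp.coeFn_smul a ξ, h1] with x e1 e2 e3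
      rw [e1, e2, Pi.smul_apply, Pi.smul_apply, e3, smul_eq_mul, smul_eq_mul, mul_left_comm]
  -- Multiplication by `F` is not known to be bounded, so the limit is taken pointwise: one
  -- subsequence makes the approximants converge almost everywhere, a further one does so for their
  -- images.
  obtain ⟨ζ, hζ, hlim⟩ := mem_closure_iff_seq_limit.1 (hs ξ)
  obtain ⟨k, hk, hae⟩ := Lp.exists_subseq_tendsto_ae hlim
  have hlim' : Filter.Tendsto (fun n => A (ζ (k n))) Filter.atTop (nhds (A ξ)) :=
    (A.continuous.tendsto ξ).comp (hlim.comp hk.tendsto_atTop)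
  obtain ⟨l, hl, hae'⟩ := Lp.exists_subseq_tendsto_ae hlim'
  have hall : ∀ᵐ x ∂ν, ∀ n, A (ζ (k (l n))) x = F x * ζ (k (l n)) x :=
    ae_all_iff.2 fun n => hspan _ (hζ _)
  filter_upwards [hae, hae', hall] with x h1 h2 h3
  refine tendsto_nhds_unique h2 ?_
  simp only [h3]
  exact (h1.comp hl.tendsto_atTop).const_mul _

/-- A function that multiplies `L²` boundedly into itself is essentially bounded. -/
theorem memLp_top_of_continuousLinearMap_mul [IsFiniteMeasure ν] (A : Lp ℂ 2 ν →L[ℂ] Lp ℂ 2 ν)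
    {F : X → ℂ} (hF : AEStronglyMeasurable F ν)
    (h : ∀ ξ : Lp ℂ 2 ν, A ξ =ᵐ[ν] fun x => F x * ξ x) : MemLp F ∞ ν := by
  refine memLp_top_of_bound hF ‖A‖ ?_
  set G := hF.mk F
  have hG : F =ᵐ[ν] G := hF.ae_eq_mk
  have hGm : Measurable G := hF.stronglyMeasurable_mk.measurable
  set E := {x | ‖A‖ < ‖G x‖}
  have hE : MeasurableSet E := measurableSet_lt measurable_const hGm.norm
  have hE0 : ν E = 0 := by
    by_contra hne
    -- Test vector: on the set where |G| > ‖A‖, the operator would stretch the indicator by more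
    -- than its norm.
    set ξ := indicatorConstLp 2 hE (measure_ne_top ν E) (1 : ℂ)
    have h1 : ∫⁻ x, ‖A ξ x‖ₑ ^ 2 ∂ν = ∫⁻ x in E, ‖G x‖ₑ ^ 2 ∂ν := by
      rw [← lintegral_indicator hE]
      refine lintegral_congr_ae ?_
      filter_upwards [h ξ, hG, indicatorConstLp_coeFn (p := 2) (hs := hE)
        (hμs := measure_ne_top ν E) (c := (1 : ℂ))] with x e1 e2 e3
      rw [e1, e2, e3]
      by_cases hx : x ∈ E <;> simp [hx]
    have h2 : ∫⁻ x, ‖A ξ x‖ₑ ^ 2 ∂ν ≤ ‖A‖ₑ ^ 2 * ν E := by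
      have hsq : ∀ η : Lp ℂ 2 ν, ∫⁻ x, ‖η x‖ₑ ^ 2 ∂ν = ‖η‖ₑ ^ 2 := fun η => by
        rw [Lp.enorm_def, eLpNorm_two_eq_rpow_lintegral, ← ENNReal.rpow_natCast, ← ENNReal.rpow_mul]
        norm_num
      have hξ : ‖ξ‖ₑ ^ 2 = ν E := by
        rw [← hsq, ← setLIntegral_one, ← lintegral_indicator hE]
        refine lintegral_congr_ae ?_
        filter_upwards [indicatorConstLp_coeFn (p := 2) (hs := hE)
          (hμs := measure_ne_top ν E) (c := (1 : ℂ))] with x e3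
        rw [e3]
        by_cases hx : x ∈ E <;> simp [hx]
      rw [hsq, ← hξ, ← mul_pow]
      gcongr
      exact A.le_opENorm ξ
    have h3 : ‖A‖ₑ ^ 2 * ν E < ∫⁻ x in E, ‖G x‖ₑ ^ 2 ∂ν := by
      rw [← setLIntegral_const]
      refine setLIntegral_strict_mono hE hne (hGm.enorm.pow_const 2) ?_ ?_
      · rw [setLIntegral_const]
        exact ENNReal.mul_ne_top (ENNReal.pow_ne_top enorm_ne_top) (measure_ne_top ν E)
      · refine Filter.Eventually.of_forall fun x hx => ?_
        have : ‖A‖ₑ < ‖G x‖ₑ := by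
          rw [← ofReal_norm, ← ofReal_norm]
          exact (ENNReal.ofReal_lt_ofReal_iff_of_nonneg (norm_nonneg _)).2 hx
        exact ENNReal.pow_lt_pow_left (by norm_num) this
    exact absurd (h1 ▸ h2) (not_le.2 h3)
  have hE' : ∀ᵐ x ∂ν, x ∉ E := measure_eq_zero_iff_ae_notMem.1 hE0
  filter_upwards [hE', hG] with x hx hx'
  rw [hx']
  exact not_lt.1 hx

end Multiplication

/-! ## Densities of images of complex measures -/

/-- The density is the conditional expectation of `g` given `p`, written as a function of `p`; the
identity is the pull-out property. -/
theorem exists_integrable_density_of_map {X Y : Type*} [MeasurableSpace X] [MeasurableSpace Y]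
    {ν : Measure X} [IsFiniteMeasure ν] {μ : Measure Y} {p : X → Y} (hp : MeasurePreserving p ν μ)
    {g : X → ℂ} (hg : Integrable g ν) :
    ∃ h : Y → ℂ, Integrable h μ ∧
      ∀ f : Y → ℂ, MemLp f ∞ μ → ∫ x, f (p x) * g x ∂ν = ∫ y, f y * h y ∂μ := by
  have hle : MeasurableSpace.comap p inferInstance ≤ (inferInstance : MeasurableSpace X) :=
    hp.measurable.comap_le
  obtain ⟨h, hh, hcomp⟩ := (stronglyMeasurable_condExp (f := g) (μ := ν)
    (m := MeasurableSpace.comap p inferInstance)).exists_eq_measurable_comp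
  have hint : Integrable h μ := by
    rw [← hp.integrable_comp hh.aestronglyMeasurable, ← hcomp]
    exact integrable_condExp
  refine ⟨h, hint, fun f hf => ?_⟩
  -- A strongly measurable version is needed so that f' ∘ p is measurable for the σ-algebra
  -- generated by `p`.
  obtain ⟨f', hf', hff⟩ := hf.1
  have hfp : (fun x => f (p x)) =ᵐ[ν] fun x => f' (p x) := hp.quasiMeasurePreserving.ae hff
  have hbd : MemLp (fun x => f (p x)) ∞ ν := hf.comp_measurePreserving hp
  have hfg : Integrable (fun x => f' (p x) * g x) ν :=
    ((memLp_one_iff_integrable.2 hg).mul (hbd.ae_eq hfp) (r := 1)).integrable le_rfl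
  have hpull := condExp_bilin_of_aestronglyMeasurable_left (ContinuousLinearMap.mul ℝ ℂ)
    (m := MeasurableSpace.comap p inferInstance) (μ := ν) (f := fun x => f' (p x)) (g := g)
    (hf'.comp_measurable (comap_measurable p)).aestronglyMeasurable hfg hg
  calc ∫ x, f (p x) * g x ∂ν = ∫ x, f' (p x) * g x ∂ν := by
        refine integral_congr_ae ?_
        filter_upwards [hfp] with x hx
        rw [hx]
    _ = ∫ x, (ν[fun x => f' (p x) * g x | MeasurableSpace.comap p inferInstance]) x ∂ν :=
        (integral_condExp hle).symm
    _ = ∫ x, f' (p x) * h (p x) ∂ν := by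
        refine integral_congr_ae (hpull.trans (Filter.Eventually.of_forall fun x => ?_))
        simp only [ContinuousLinearMap.mul_apply']
        rw [hcomp]
        rfl
    _ = ∫ y, f' y * h y ∂μ := by
        rw [← hp.map_eq, integral_map hp.measurable.aemeasurable]
        exact (hf'.mul hh).aestronglyMeasurable
    _ = ∫ y, f y * h y ∂μ := by
        refine integral_congr_ae ?_
        filter_upwards [hff] with y hy
        rw [hy]

/-! ## Inverse branches and Lebesgue measure -/

/-- Lebesgue measure on `[0,1)`. -/
abbrev lebesgueIco : Measure ℝ := (volume : Measure ℝ).restrict (Set.Ico 0 1)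

theorem continuous_circleParam : Continuous circleParam := by
  unfold circleParam
  fun_prop

theorem measurePreserving_circleParam : MeasurePreserving circleParam lebesgueIco circleMeasure :=
  ⟨continuous_circleParam.measurable, rfl⟩

instance : IsProbabilityMeasure lebesgueIco := ⟨by simp⟩

instance : IsProbabilityMeasure circleMeasure :=
  Measure.isProbabilityMeasure_map continuous_circleParam.measurable.aemeasurable

theorem measurable_branch (N : ℕ) (k : Fin N) : Measurable (branch N k) := by
  unfold branch
  fun_prop

/-- Affine substitution: the branch maps [0,1) onto the k-th of N equal intervals and contracts
lengths by N. -/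
theorem lintegral_comp_branch (N : ℕ) [NeZero N] (k : Fin N) (g : ℝ → ℝ≥0∞) (hg : Measurable g) :
    ∫⁻ x, g (branch N k x) ∂lebesgueIco =
      N * ∫⁻ x in Set.Ico (((k : ℕ) : ℝ) / N) ((((k : ℕ) + 1 : ℕ) : ℝ) / N), g x := by
  have hN : (0 : ℝ) < N := Nat.cast_pos.2 (NeZero.pos N)
  set s := Set.Ico (((k : ℕ) : ℝ) / N) ((((k : ℕ) + 1 : ℕ) : ℝ) / N)
  have hmem : ∀ x : ℝ, x ∈ Set.Ico (0 : ℝ) 1 ↔ branch N k x ∈ s := fun x => by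
    simp only [s, branch, Set.mem_Ico, Nat.cast_add, Nat.cast_one,
      div_le_div_iff_of_pos_right hN, div_lt_div_iff_of_pos_right hN]
    constructor <;> rintro ⟨h1, h2⟩ <;> constructor <;> linarith
  have hf : Measurable (s.indicator g) := hg.indicator measurableSet_Ico
  calc ∫⁻ x, g (branch N k x) ∂lebesgueIco
      = ∫⁻ x, s.indicator g (branch N k x) := by
        rw [← lintegral_indicator measurableSet_Ico]
        refine lintegral_congr fun x => ?_
        by_cases hx : x ∈ Set.Ico (0 : ℝ) 1
        · rw [Set.indicator_of_mem hx, Set.indicator_of_mem ((hmem x).1 hx)]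
        · rw [Set.indicator_of_notMem hx, Set.indicator_of_notMem (mt (hmem x).2 hx)]
    _ = ∫⁻ x, s.indicator g (x * (N : ℝ)⁻¹) := by
        rw [← lintegral_add_right_eq_self (μ := volume)
          (fun x : ℝ => s.indicator g (x * (N : ℝ)⁻¹)) (((k : ℕ) : ℝ))]
        rfl
    _ = N * ∫⁻ x in s, g x := by
        rw [← lintegral_indicator measurableSet_Ico]
        have h := Real.smul_map_volume_mul_right (inv_ne_zero hN.ne')
        conv_rhs => rw [← h]
        rw [lintegral_smul_measure, lintegral_map hf (measurable_mul_const _),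
          abs_of_pos (inv_pos.2 hN), ENNReal.ofReal_inv_of_pos hN, ENNReal.ofReal_natCast,
          smul_eq_mul, ← mul_assoc, ENNReal.mul_inv_cancel (by simp [NeZero.ne N]) (by simp),
          one_mul]

theorem sum_lintegral_comp_branch_of_measurable (N : ℕ) [NeZero N] {g : ℝ → ℝ≥0∞}
    (hg : Measurable g) :
    ∑ k : Fin N, ∫⁻ x, g (branch N k x) ∂lebesgueIco = N * ∫⁻ x, g x ∂lebesgueIco := by
  have hN : (0 : ℝ) < N := Nat.cast_pos.2 (NeZero.pos N)
  simp only [lintegral_comp_branch N _ g hg, ← Finset.mul_sum]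
  congr 1
  rw [Fin.sum_univ_eq_sum_range
    (fun k => ∫⁻ x in Set.Ico ((k : ℝ) / N) (((k + 1 : ℕ) : ℝ) / N), g x)]
  have key : ∀ n : ℕ, ∑ k ∈ Finset.range n,
      ∫⁻ x in Set.Ico ((k : ℝ) / N) (((k + 1 : ℕ) : ℝ) / N), g x =
        ∫⁻ x in Set.Ico (0 : ℝ) ((n : ℝ) / N), g x := by
    intro n
    induction n with
    | zero => simp
    | succ n ih =>
      rw [Finset.sum_range_succ, ih, ← lintegral_union measurableSet_Ico
        (Set.Ico_disjoint_Ico_same), Set.Ico_union_Ico_eq_Ico (by positivity)]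
      gcongr
      simp
  rw [key, div_self hN.ne']

/-- The images of the branches tile [0,1), so the measures of the preimages of a null set sum to N ·
0, and each of them vanishes. -/
theorem quasiMeasurePreserving_branch (N : ℕ) [NeZero N] (k : Fin N) :
    Measure.QuasiMeasurePreserving (branch N k) lebesgueIco lebesgueIco := by
  refine ⟨measurable_branch N k, Measure.AbsolutelyContinuous.mk fun s hs h0 => ?_⟩
  rw [Measure.map_apply (measurable_branch N k) hs]
  have h := sum_lintegral_comp_branch_of_measurable N
    (g := s.indicator 1) (measurable_one.indicator hs)
  rw [lintegral_indicator_one hs, h0, mul_zero, Finset.sum_eq_zero_iff] at h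
  rw [← h k (Finset.mem_univ k), ← lintegral_indicator_one (measurable_branch N k hs)]
  rfl

theorem ae_forall_walkPos (N : ℕ) [NeZero N] {Q : ℝ → Prop} (hQ : ∀ᵐ x ∂lebesgueIco, Q x) :
    ∀ᵐ x ∂lebesgueIco, ∀ (n : ℕ) (a : ℕ → Fin N), Q (walkPos N x a n) := by
  refine ae_all_iff.2 fun n => ?_
  induction n generalizing Q with
  | zero =>
    filter_upwards [hQ] with x hx a
    exact hx
  | succ n ih =>
    -- Strengthening Q to hold at all branch points keeps the uncountable quantifier over digit
    -- sequences away from null sets: each step intersects finitely many conditions.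
    have h := ih (Q := fun x => ∀ k, Q (branch N k x))
      (ae_all_iff.2 fun k => (quasiMeasurePreserving_branch N k).ae hQ)
    filter_upwards [h] with x hx a
    exact hx a (a n)

/-! ## The roots of a point of the circle -/

theorem circleParam_eq_circleParam_iff {x y : ℝ} :
    circleParam x = circleParam y ↔ ∃ m : ℤ, x = y + m := by
  have hpi : (2 * Real.pi : ℝ) ≠ 0 := by positivity
  unfold circleParam
  rw [Circle.exp_eq_exp]
  constructor
  · rintro ⟨m, hm⟩
    refine ⟨-m, ?_⟩
    have : 2 * Real.pi * x = 2 * Real.pi * (y + ((-m : ℤ) : ℝ)) := by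
      push_cast
      linarith
    exact mul_left_cancel₀ hpi this
  · rintro ⟨m, rfl⟩
    exact ⟨-m, by push_cast; ring⟩

theorem circleParam_branch_injective (N : ℕ) [NeZero N] (x : ℝ) :
    Function.Injective fun k : Fin N => circleParam (branch N k x) := by
  intro k l hkl
  obtain ⟨m, hm⟩ := circleParam_eq_circleParam_iff.1 hkl
  have hN : (N : ℝ) ≠ 0 := Nat.cast_ne_zero.mpr (NeZero.ne N)
  unfold branch at hm
  field_simp at hm
  have h : ((k : ℕ) : ℤ) = ((l : ℕ) : ℤ) + N * m := by
    have : (((k : ℕ) : ℤ) : ℝ) = ((((l : ℕ) : ℤ) + N * m : ℤ) : ℝ) := by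
      push_cast
      linarith
    exact_mod_cast this
  have hmod : ((k : ℕ) : ℤ) ≡ ((l : ℕ) : ℤ) [ZMOD N] := by
    rw [h]
    simp [Int.ModEq]
  have := Int.natCast_modEq_iff.1 hmod
  exact Fin.ext (Nat.ModEq.eq_of_lt_of_lt this k.2 l.2)

theorem setOf_pow_eq_circleParam (N : ℕ) [NeZero N] (x : ℝ) :
    {w : Circle | w ^ N = circleParam x} = Set.range fun k : Fin N => circleParam (branch N k x) := by
  have hN : (N : ℝ) ≠ 0 := Nat.cast_ne_zero.mpr (NeZero.ne N)
  ext w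
  constructor
  · intro hw
    obtain ⟨y, rfl⟩ : ∃ y, circleParam y = w := by
      refine ⟨-(Complex.arg w / (2 * Real.pi)), ?_⟩
      have : -(2 * Real.pi * -(Complex.arg w / (2 * Real.pi))) = Complex.arg w := by
        field_simp
      rw [circleParam, this, Circle.exp_arg]
    have hy : circleParam (N * y) = circleParam x := by
      rw [← (show circleParam y ^ N = circleParam x from hw), circleParam, circleParam,
        ← Circle.exp_natCast_mul]
      congr 1
      ring
    obtain ⟨m, hm⟩ := circleParam_eq_circleParam_iff.1 hy
    have hNz : (0 : ℤ) < N := by exact_mod_cast NeZero.pos N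
    have h0 : 0 ≤ m % N := Int.emod_nonneg _ hNz.ne'
    have h1 : m % N < N := Int.emod_lt_of_pos _ hNz
    -- Here y = (x + m)/N. The remainder of m modulo N is the digit, and the quotient is an integer
    -- translation that `circleParam` does not see.
    refine ⟨⟨(m % N).toNat, by omega⟩, circleParam_eq_circleParam_iff.2 ⟨-(m / N), ?_⟩⟩
    have h2 : (((m % N).toNat : ℕ) : ℝ) = ((m % N : ℤ) : ℝ) := by
      exact_mod_cast congrArg (fun z : ℤ => (z : ℝ)) (Int.toNat_of_nonneg h0)
    have h3 : (m : ℝ) = N * ((m / N : ℤ) : ℝ) + ((m % N : ℤ) : ℝ) := by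
      exact_mod_cast congrArg (fun z : ℤ => (z : ℝ)) (Int.mul_ediv_add_emod m N).symm
    simp only [branch, h2]
    have hy : y = (x + m) / N := by
      rw [← hm]
      field_simp
    rw [hy, h3]
    push_cast
    field_simp
    ring
  · rintro ⟨k, rfl⟩
    exact circleParam_branch N k x

theorem ruelle_circleParam (N : ℕ) [NeZero N] (m₀ : Circle → ℂ) (x : ℝ) :
    ruelle N m₀ (fun _ => 1) (circleParam x) =
      ((∑ k : Fin N, filterWeight N m₀ (circleParam (branch N k x)) : ℝ) : ℂ) := by
  unfold ruelle filterWeight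
  rw [setOf_pow_eq_circleParam, finsum_mem_range (circleParam_branch_injective N x),
    finsum_eq_sum_of_fintype, ← Finset.sum_div]
  push_cast
  simp only [mul_one]
  ring

theorem ae_sum_filterWeight_branch_eq_one (N : ℕ) [NeZero N] {m₀ : Circle → ℂ}
    (hR : ruelle N m₀ (fun _ => 1) =ᵐ[circleMeasure] fun _ => 1) :
    ∀ᵐ x ∂lebesgueIco, ∑ k : Fin N, filterWeight N m₀ (circleParam (branch N k x)) = 1 := by
  filter_upwards [measurePreserving_circleParam.quasiMeasurePreserving.ae hR] with x hx
  rw [ruelle_circleParam] at hx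
  exact_mod_cast hx

/-! ## The Markov property of the walk -/

section Markov

theorem walkPos_congr (N : ℕ) {x : ℝ} {a b : ℕ → Fin N} {n : ℕ} (h : ∀ i < n, a i = b i) :
    walkPos N x a n = walkPos N x b n := by
  induction n with
  | zero => rfl
  | succ n ih =>
    simp only [walkPos]
    rw [ih fun i hi => h i (Nat.lt_succ_of_lt hi), h n (Nat.lt_succ_self n)]

variable (N : ℕ) [NeZero N] (W : Circle → ℝ)

theorem walkMeasure_map_frestrictLe_zero (x : ℝ) :
    (walkMeasure N W x).map (Preorder.frestrictLe (π := fun _ => Fin N) 0) =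
      (stepLaw N W x).map (MeasurableEquiv.piUnique fun _ : Finset.Iic (0 : ℕ) => Fin N).symm := by
  unfold walkMeasure Kernel.trajMeasure
  rw [Measure.map_comp _ _ (by fun_prop), Kernel.traj_map_frestrictLe, Kernel.partialTraj_self,
    Measure.id_comp]

theorem lintegral_walkMeasure_zero (x : ℝ) (f : Fin N → ℝ≥0∞) :
    ∫⁻ ω, f (ω 0) ∂walkMeasure N W x = ∫⁻ k, f k ∂stepLaw N W x := by
  have hm : Measurable fun p : (Finset.Iic (0 : ℕ) → Fin N) => f (p ⟨0, by simp⟩) :=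
    measurable_of_countable _
  have h := lintegral_map (μ := walkMeasure N W x) hm
    (Preorder.measurable_frestrictLe (X := fun _ => Fin N) 0)
  rw [walkMeasure_map_frestrictLe_zero, lintegral_map hm (MeasurableEquiv.measurable _)] at h
  exact h.symm

/-- Given the first `n` digits, the next digit is drawn from the step law at the current
position. -/
theorem lintegral_walkMeasure (x : ℝ) (n : ℕ) {F : (ℕ → Fin N) → Fin N → ℝ≥0∞}
    (hF : ∀ ω ω' : ℕ → Fin N, (∀ i < n, ω i = ω' i) → F ω = F ω') :
    ∫⁻ ω, F ω (ω n) ∂walkMeasure N W x =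
      ∫⁻ ω, ∫⁻ k, F ω k ∂stepLaw N W (walkPos N x ω n) ∂walkMeasure N W x := by
  cases n with
  | zero =>
    have h0 : ∀ ω, F ω = F 0 := fun ω => hF _ _ (by simp)
    simp only [h0, walkPos, lintegral_const, measure_univ, mul_one]
    exact lintegral_walkMeasure_zero N W x (F 0)
  | succ n =>
    -- `e` pads a prefix with zeros exactly as `walkKernel` does, so the kernel unfolds to it
    -- definitionally. Position n + 1 uses only the digits 0, …, n and does not see the padding.
    let e : (Finset.Iic n → Fin N) → ℕ → Fin N := fun p i =>
      if hi : i ≤ n then p ⟨i, Finset.mem_Iic.mpr hi⟩ else 0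
    have he : ∀ ω : ℕ → Fin N, ∀ i < n + 1,
        e (Preorder.frestrictLe (π := fun _ => Fin N) n ω) i = ω i := fun ω i hi => by
      simp [e, Nat.lt_succ_iff.1 hi]
    -- Prefixes form a finite discrete space, so dependence on finitely many digits replaces any
    -- measurability assumption on `F`.
    have hm : Measurable fun q : (Finset.Iic n → Fin N) × Fin N => F (e q.1) q.2 :=
      measurable_of_countable _
    have h1 := lintegral_map (μ := walkMeasure N W x) hm
      (g := fun ω => (Preorder.frestrictLe (π := fun _ => Fin N) n ω, ω (n + 1)))
      (by fun_prop)
    have h2 : (walkMeasure N W x).map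
        (fun ω => (Preorder.frestrictLe (π := fun _ => Fin N) n ω, ω (n + 1))) =
          (walkMeasure N W x).map (Preorder.frestrictLe (π := fun _ => Fin N) n) ⊗ₘ
            walkKernel N W x n :=
      (Kernel.map_frestrictLe_trajMeasure_compProd_eq_map_trajMeasure
        (X := fun _ => Fin N) (μ₀ := stepLaw N W x) (κ := walkKernel N W x) (a := n)).symm
    rw [h2, Measure.lintegral_compProd hm, lintegral_map (measurable_of_countable _)
      (Preorder.measurable_frestrictLe (X := fun _ => Fin N) n)] at h1
    calc ∫⁻ ω, F ω (ω (n + 1)) ∂walkMeasure N W x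
        = ∫⁻ ω, F (e (Preorder.frestrictLe (π := fun _ => Fin N) n ω)) (ω (n + 1))
            ∂walkMeasure N W x := lintegral_congr fun ω => by rw [hF _ _ (he ω)]
      _ = _ := h1.symm
      _ = _ := lintegral_congr fun ω => by
        simp only
        rw [hF _ _ (he ω)]
        change ∫⁻ k, F ω k ∂stepLaw N W (walkPos N x (e (Preorder.frestrictLe n ω)) (n + 1)) = _
        rw [walkPos_congr N (he ω)]

variable {W}

theorem lintegral_stepLaw (hW : ∀ z, 0 ≤ W z) {y : ℝ}
    (hy : ∑ k : Fin N, W (circleParam (branch N k y)) = 1) (f : Fin N → ℝ≥0∞) :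
    ∫⁻ k, f k ∂stepLaw N W y =
      ∑ k : Fin N, ENNReal.ofReal (W (circleParam (branch N k y))) * f k := by
  unfold stepLaw
  rw [if_pos ⟨fun k => hW _, hy⟩, lintegral_finsetSum_measure]
  refine Finset.sum_congr rfl fun k _ => ?_
  rw [lintegral_smul_measure, lintegral_dirac, smul_eq_mul]

/-- The cylinder formula of the walk. -/
theorem walkMeasure_cylinder (hW : ∀ z, 0 ≤ W z) {x : ℝ}
    (hx : ∀ (n : ℕ) (a : ℕ → Fin N),
      ∑ k : Fin N, W (circleParam (branch N k (walkPos N x a n))) = 1)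
    (n : ℕ) (a : ℕ → Fin N) :
    walkMeasure N W x {ω | ∀ i < n, ω i = a i} =
      ENNReal.ofReal (∏ i ∈ Finset.range n, W (circleParam (walkPos N x a (i + 1)))) := by
  classical
  have hmeas : ∀ n, MeasurableSet {ω : ℕ → Fin N | ∀ i < n, ω i = a i} := fun n => by
    simp only [Set.ofPred_forall]
    exact MeasurableSet.iInter fun i => MeasurableSet.iInter fun _ =>
      measurable_pi_apply i (measurableSet_singleton _)
  induction n with
  | zero => simp
  | succ n ih =>
    -- The cylinder of length n + 1 splits into a condition on the first n digits and one on the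
    -- next digit, the form required by `lintegral_walkMeasure`.
    let F : (ℕ → Fin N) → Fin N → ℝ≥0∞ := fun ω k =>
      {ω : ℕ → Fin N | ∀ i < n, ω i = a i}.indicator 1 ω * (if k = a n then 1 else 0)
    have hF : ∀ ω ω' : ℕ → Fin N, (∀ i < n, ω i = ω' i) → F ω = F ω' := by
      intro ω ω' h
      have : (∀ i < n, ω i = a i) ↔ ∀ i < n, ω' i = a i :=
        forall₂_congr fun i hi => by rw [h i hi]
      ext k
      simp only [F, Set.indicator_apply, Set.mem_ofPred_eq, this, Pi.one_apply]
    have h := lintegral_walkMeasure N W x n hF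
    have hl : ∫⁻ ω, F ω (ω n) ∂walkMeasure N W x =
        walkMeasure N W x {ω | ∀ i < n + 1, ω i = a i} := by
      rw [← lintegral_indicator_one (hmeas (n + 1))]
      refine lintegral_congr fun ω => ?_
      simp only [F, Set.indicator_apply, Set.mem_ofPred_eq, Nat.lt_succ_iff_lt_or_eq,
        or_imp, forall_and, forall_eq, Pi.one_apply]
      by_cases h1 : ∀ i < n, ω i = a i <;> by_cases h2 : ω n = a n <;> simp [h1, h2]
    rw [← hl, h, Finset.prod_range_succ, ENNReal.ofReal_mul (Finset.prod_nonneg fun _ _ => hW _),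
      ← ih, ← lintegral_indicator_one (hmeas n), ← lintegral_mul_const _
        (measurable_one.indicator (hmeas n))]
    refine lintegral_congr fun ω => ?_
    rw [lintegral_stepLaw N hW (hx n ω)]
    by_cases h1 : ω ∈ {ω : ℕ → Fin N | ∀ i < n, ω i = a i}
    · simp only [F, Set.indicator_of_mem h1, Pi.one_apply, one_mul, mul_ite, mul_one, mul_zero,
        Finset.sum_ite_eq', Finset.mem_univ, if_true]
      rw [walkPos_congr N h1]
      rfl
    · simp [F, Set.indicator_of_notMem h1]

/-- One step of the walk integrates a function of the position to its Ruelle transform. -/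
theorem lintegral_walkPos_succ (hW : ∀ z, 0 ≤ W z) {x : ℝ}
    (hx : ∀ (n : ℕ) (a : ℕ → Fin N),
      ∑ k : Fin N, W (circleParam (branch N k (walkPos N x a n))) = 1)
    (n : ℕ) (g : ℝ → ℝ≥0∞) :
    ∫⁻ ω, g (walkPos N x ω (n + 1)) ∂walkMeasure N W x =
      ∫⁻ ω, ∑ k : Fin N, ENNReal.ofReal (W (circleParam (branch N k (walkPos N x ω n)))) *
        g (branch N k (walkPos N x ω n)) ∂walkMeasure N W x := by
  have h := lintegral_walkMeasure N W x n (F := fun ω k => g (branch N k (walkPos N x ω n)))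
    (fun ω ω' h => by rw [walkPos_congr N h])
  refine Eq.trans h (lintegral_congr fun ω => ?_)
  rw [lintegral_stepLaw N hW (hx n ω)]

end Markov

/-! ## Measures on the solenoid -/

theorem Solenoid.coord_add_pow {N : ℕ} (z : Solenoid N) (n k : ℕ) :
    z.1 (n + k) ^ N ^ k = z.1 n := by
  induction k with
  | zero => simp
  | succ k ih => rw [pow_succ', pow_mul, ← add_assoc, z.2, ih]

theorem Solenoid.measurable_coord (N n : ℕ) : Measurable fun z : Solenoid N => z.1 n :=
  (measurable_pi_apply n).comp measurable_subtype_coe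

/-- The sets determined by one coordinate. -/
def Solenoid.coordSets (N : ℕ) : Set (Set (Solenoid N)) :=
  {s | ∃ (n : ℕ) (B : Set Circle), MeasurableSet B ∧ s = (fun z : Solenoid N => z.1 n) ⁻¹' B}

/-- As z_n = z_{n+k}^{N^k}, conditions on two coordinates amount to a single condition on the later
one. -/
theorem Solenoid.isPiSystem_coordSets (N : ℕ) : IsPiSystem (Solenoid.coordSets N) := by
  have key : ∀ (n k : ℕ) (B C : Set Circle), MeasurableSet B → MeasurableSet C →
      (fun z : Solenoid N => z.1 n) ⁻¹' B ∩ (fun z : Solenoid N => z.1 (n + k)) ⁻¹' C ∈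
        Solenoid.coordSets N := by
    intro n k B C hB hC
    refine ⟨n + k, (fun z => z ^ N ^ k) ⁻¹' B ∩ C,
      ((continuous_pow _).measurable hB).inter hC, ?_⟩
    ext z
    simp only [Set.mem_inter_iff, Set.mem_preimage, z.coord_add_pow]
  rintro _ ⟨n, B, hB, rfl⟩ _ ⟨m, C, hC, rfl⟩ -
  rcases le_total n m with h | h
  · obtain ⟨k, rfl⟩ := Nat.exists_eq_add_of_le h
    exact key n k B C hB hC
  · obtain ⟨k, rfl⟩ := Nat.exists_eq_add_of_le h
    rw [Set.inter_comm]
    exact key m k C B hC hB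

theorem Solenoid.generateFrom_coordSets (N : ℕ) :
    (inferInstance : MeasurableSpace (Solenoid N)) =
      MeasurableSpace.generateFrom (Solenoid.coordSets N) := by
  refine le_antisymm ?_ (MeasurableSpace.generateFrom_le ?_)
  · change MeasurableSpace.comap _ (⨆ n, MeasurableSpace.comap _ _) ≤ _
    rw [MeasurableSpace.comap_iSup]
    refine iSup_le fun n => ?_
    rw [MeasurableSpace.comap_comp]
    rintro _ ⟨B, hB, rfl⟩
    exact MeasurableSpace.measurableSet_generateFrom ⟨n, B, hB, rfl⟩
  · rintro _ ⟨n, B, hB, rfl⟩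
    exact Solenoid.measurable_coord N n hB

/-- A finite measure on the solenoid is determined by the laws of the coordinates. -/
theorem Solenoid.measure_ext {N : ℕ} {ν ν' : Measure (Solenoid N)} [IsFiniteMeasure ν]
    (h : ∀ n, ν.map (fun z => z.1 n) = ν'.map fun z => z.1 n) : ν = ν' := by
  refine ext_of_generate_finite _ (Solenoid.generateFrom_coordSets N)
    (Solenoid.isPiSystem_coordSets N) ?_ ?_
  · rintro _ ⟨n, B, hB, rfl⟩
    rw [← Measure.map_apply (Solenoid.measurable_coord N n) hB, h n,
      Measure.map_apply (Solenoid.measurable_coord N n) hB]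
  · have h1 := congrArg (fun μ : Measure Circle => μ Set.univ) (h 0)
    simpa [Measure.map_apply (Solenoid.measurable_coord N 0) MeasurableSet.univ] using h1

theorem measurable_shift (N : ℕ) : Measurable (shift N) :=
  Measurable.subtype_mk (measurable_pi_lambda _ fun n =>
    (continuous_pow N).measurable.comp (Solenoid.measurable_coord N n))

theorem measurable_shift_symm (N : ℕ) : Measurable (shift N).symm :=
  Measurable.subtype_mk (measurable_pi_lambda _ fun n => Solenoid.measurable_coord N (n + 1))

/-- The shift as a measurable equivalence. -/
def shiftEquiv (N : ℕ) : Solenoid N ≃ᵐ Solenoid N where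
  toEquiv := shift N
  measurable_toFun := measurable_shift N
  measurable_invFun := measurable_shift_symm N

/-! ## The transfer operator of the walk -/

section Transfer

variable (N : ℕ)

/-- The Ruelle operator in the coordinate `x` of the circle. -/
def branchTransfer (W : Circle → ℝ) (g : ℝ → ℝ≥0∞) (y : ℝ) : ℝ≥0∞ :=
  ∑ k : Fin N, ENNReal.ofReal (W (circleParam (branch N k y))) * g (branch N k y)

theorem measurable_branchTransfer {W : Circle → ℝ} (hW : Measurable W) {g : ℝ → ℝ≥0∞}
    (hg : Measurable g) : Measurable (branchTransfer N W g) := by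
  unfold branchTransfer
  refine Finset.measurable_sum _ fun k _ => ?_
  have hk := measurable_branch N k
  exact (ENNReal.measurable_ofReal.comp (hW.comp (continuous_circleParam.measurable.comp hk))).mul
    (hg.comp hk)

theorem measurable_branchTransfer_iterate {W : Circle → ℝ} (hW : Measurable W) {g : ℝ → ℝ≥0∞}
    (hg : Measurable g) (n : ℕ) : Measurable ((branchTransfer N W)^[n] g) := by
  induction n generalizing g with
  | zero => exact hg
  | succ n ih => exact ih (measurable_branchTransfer N hW hg)

/-- Two weights occur because the walk is defined by `W`, which may be measurable only up to null
sets, while integration in x uses a measurable version `W'`. They need to agree only at points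
reachable from x. -/
theorem lintegral_walkPos_eq_iterate [NeZero N] {W W' : Circle → ℝ} (hW : ∀ z, 0 ≤ W z) {x : ℝ}
    (hx : ∀ (n : ℕ) (a : ℕ → Fin N),
      ∑ k : Fin N, W (circleParam (branch N k (walkPos N x a n))) = 1)
    (hx' : ∀ (n : ℕ) (a : ℕ → Fin N) (k : Fin N),
      W (circleParam (branch N k (walkPos N x a n))) =
        W' (circleParam (branch N k (walkPos N x a n))))
    (n : ℕ) (g : ℝ → ℝ≥0∞) :
    ∫⁻ ω, g (walkPos N x ω n) ∂walkMeasure N W x = (branchTransfer N W')^[n] g x := by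
  induction n generalizing g with
  | zero => simp [walkPos]
  | succ n ih =>
    rw [lintegral_walkPos_succ N hW hx, Function.iterate_succ_apply, ← ih]
    refine lintegral_congr fun ω => ?_
    simp only [hx', branchTransfer]

/-- The density `∏_{j < n} |w(z^{N^j})|²` of the law of the `n`-th coordinate of the walk. -/
def filterDensity (w : Circle → ℂ) (n : ℕ) (z : Circle) : ℝ≥0∞ :=
  ∏ j ∈ Finset.range n, ‖w (z ^ N ^ j)‖ₑ ^ 2

theorem filterDensity_succ (w : Circle → ℂ) (n : ℕ) (z : Circle) :
    filterDensity N w (n + 1) z = filterDensity N w n z * ‖w (z ^ N ^ n)‖ₑ ^ 2 :=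
  Finset.prod_range_succ _ _

theorem filterDensity_succ' (w : Circle → ℂ) (n : ℕ) (z : Circle) :
    filterDensity N w (n + 1) z = filterDensity N w n (z ^ N) * ‖w z‖ₑ ^ 2 := by
  unfold filterDensity
  rw [Finset.prod_range_succ']
  simp only [pow_succ', pow_mul, pow_zero, pow_one]

theorem measurable_filterDensity {w : Circle → ℂ} (hw : Measurable w) (n : ℕ) :
    Measurable (filterDensity N w n) := by
  unfold filterDensity
  exact Finset.measurable_prod _ fun j _ =>
    (hw.comp (continuous_pow _).measurable).enorm.pow_const 2

theorem measurable_filterWeight {w : Circle → ℂ} (hw : Measurable w) :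
    Measurable (filterWeight N w) := by
  unfold filterWeight
  exact (hw.norm.pow_const 2).div_const _

theorem filterWeight_nonneg (w : Circle → ℂ) (z : Circle) : 0 ≤ filterWeight N w z := by
  unfold filterWeight
  positivity

theorem natCast_mul_ofReal_filterWeight [NeZero N] (w : Circle → ℂ) (z : Circle) :
    (N : ℝ≥0∞) * ENNReal.ofReal (filterWeight N w z) = ‖w z‖ₑ ^ 2 := by
  have hN : (N : ℝ) ≠ 0 := Nat.cast_ne_zero.mpr (NeZero.ne N)
  rw [← ENNReal.ofReal_natCast, ← ENNReal.ofReal_mul (Nat.cast_nonneg N), filterWeight,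
    mul_div_cancel₀ _ hN, ENNReal.ofReal_pow (norm_nonneg _), ofReal_norm]

/-- This is the duality between the Ruelle operator and multiplication by |w|². At a branch point y
of x the factor depending on x becomes a function of z^N, where z is the circle point of y; summing
over the branches restores the integral over [0,1) with a factor N, which turns |w|²/N into |w|². -/
theorem lintegral_branchTransfer_iterate [NeZero N] {w : Circle → ℂ} (hw : Measurable w) {g : ℝ → ℝ≥0∞}
    (hg : Measurable g) (n : ℕ) :
    ∫⁻ x, (branchTransfer N (filterWeight N w))^[n] g x ∂lebesgueIco =
      ∫⁻ x, filterDensity N w n (circleParam x) * g x ∂lebesgueIco := by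
  have hc := continuous_circleParam.measurable
  have hW : Measurable fun x => ENNReal.ofReal (filterWeight N w (circleParam x)) :=
    ENNReal.measurable_ofReal.comp ((measurable_filterWeight N hw).comp hc)
  induction n generalizing g with
  | zero => simp [filterDensity]
  | succ n ih =>
    rw [Function.iterate_succ_apply,
      ih (measurable_branchTransfer N (measurable_filterWeight N hw) hg)]
    set h : ℝ → ℝ≥0∞ := fun y => filterDensity N w n (circleParam y ^ N) *
      (ENNReal.ofReal (filterWeight N w (circleParam y)) * g y)
    have hh : Measurable h :=
      ((measurable_filterDensity N hw n).comp ((continuous_pow N).measurable.comp hc)).mul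
        (hW.mul hg)
    have e1 : ∀ x, filterDensity N w n (circleParam x) *
        branchTransfer N (filterWeight N w) g x = ∑ k : Fin N, h (branch N k x) := fun x => by
      simp only [h, branchTransfer, Finset.mul_sum, circleParam_branch N]
    simp only [e1]
    rw [lintegral_finsetSum (f := fun k x => h (branch N k x)) _
        fun k _ => hh.comp (measurable_branch N k),
      sum_lintegral_comp_branch_of_measurable N hh, ← lintegral_const_mul _ hh]
    refine lintegral_congr fun x => ?_
    rw [filterDensity_succ', ← natCast_mul_ofReal_filterWeight N]
    simp only [h]
    ring

end Transfer

/-! ## The random-walk measure -/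

section FilterMeasure

variable {N : ℕ} [NeZero N] {m₀ : Circle → ℂ}

theorem ae_walkMeasure_cylinder (hR : ruelle N m₀ (fun _ => 1) =ᵐ[circleMeasure] fun _ => 1) :
    ∀ᵐ x ∂lebesgueIco, ∀ (n : ℕ) (a : ℕ → Fin N),
      walkMeasure N (filterWeight N m₀) x {ω | ∀ i < n, ω i = a i} =
        ENNReal.ofReal
          (∏ i ∈ Finset.range n, filterWeight N m₀ (circleParam (walkPos N x a (i + 1)))) := by
  filter_upwards [ae_forall_walkPos N (ae_sum_filterWeight_branch_eq_one N hR)] with x hx n a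
  exact walkMeasure_cylinder N (filterWeight_nonneg N m₀) hx n a

theorem ae_lintegral_walkPos (hR : ruelle N m₀ (fun _ => 1) =ᵐ[circleMeasure] fun _ => 1)
    {w : Circle → ℂ} (hw : m₀ =ᵐ[circleMeasure] w) :
    ∀ᵐ x ∂lebesgueIco, ∀ (n : ℕ) (g : ℝ → ℝ≥0∞),
      ∫⁻ ω, g (walkPos N x ω n) ∂walkMeasure N (filterWeight N m₀) x =
        (branchTransfer N (filterWeight N w))^[n] g x := by
  have hw' : ∀ᵐ x ∂lebesgueIco, ∀ k : Fin N, filterWeight N m₀ (circleParam (branch N k x)) =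
      filterWeight N w (circleParam (branch N k x)) := by
    refine ae_all_iff.2 fun k => ?_
    filter_upwards [(quasiMeasurePreserving_branch N k).ae
      (measurePreserving_circleParam.quasiMeasurePreserving.ae hw)] with x hx
    rw [filterWeight, hx, filterWeight]
  filter_upwards [ae_forall_walkPos N (ae_sum_filterWeight_branch_eq_one N hR),
    ae_forall_walkPos N hw'] with x hx hx' n g
  exact lintegral_walkPos_eq_iterate N (filterWeight_nonneg N m₀) hx hx' n g

theorem walkMeasure_map_solenoidPath_coord (W : Circle → ℝ) (x : ℝ) (n : ℕ) {B : Set Circle}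
    (hB : MeasurableSet B) :
    (walkMeasure N W x).map (solenoidPath N x) ((fun z : Solenoid N => z.1 n) ⁻¹' B) =
      ∫⁻ ω, (circleParam ⁻¹' B).indicator 1 (walkPos N x ω n) ∂walkMeasure N W x := by
  rw [Measure.map_apply (measurable_solenoidPath N x) (Solenoid.measurable_coord N n hB),
    ← lintegral_indicator_one
      (measurable_solenoidPath N x (Solenoid.measurable_coord N n hB))]
  rfl

instance (W : Circle → ℝ) (x : ℝ) :
    IsProbabilityMeasure ((walkMeasure N W x).map (solenoidPath N x)) :=
  Measure.isProbabilityMeasure_map (measurable_solenoidPath N x).aemeasurable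

/-- Without this the `bind` defining m would be a junk value. Measurability in x need only be
checked on the π-system of one-coordinate sets, where the probability is an iterate of the transfer
operator for a measurable version of m₀. -/
theorem aemeasurable_walkMeasure_map (hm : AEStronglyMeasurable m₀ circleMeasure)
    (hR : ruelle N m₀ (fun _ => 1) =ᵐ[circleMeasure] fun _ => 1) :
    AEMeasurable (fun x => (walkMeasure N (filterWeight N m₀) x).map (solenoidPath N x))
      lebesgueIco := by
  classical
  obtain ⟨w, hw, hmw⟩ := hm
  obtain ⟨T, hTsub, hT, hT0⟩ := exists_measurable_superset_of_null (ae_lintegral_walkPos hR hmw)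
  have hgood : ∀ x ∉ T, ∀ (n : ℕ) (g : ℝ → ℝ≥0∞),
      ∫⁻ ω, g (walkPos N x ω n) ∂walkMeasure N (filterWeight N m₀) x =
        (branchTransfer N (filterWeight N w))^[n] g x := fun x hx => by
    by_contra h
    exact hx (hTsub h)
  -- On the exceptional null set any fixed probability measure would do; the walk from 0 is one.
  let κ : ℝ → Measure (Solenoid N) := fun x => if x ∈ T then
    (walkMeasure N (filterWeight N m₀) 0).map (solenoidPath N 0) else
    (walkMeasure N (filterWeight N m₀) x).map (solenoidPath N x)
  have hprob : ∀ x, IsProbabilityMeasure (κ x) := fun x => by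
    simp only [κ]
    split_ifs <;> infer_instance
  refine ⟨κ, ?_, ?_⟩
  · refine Measurable.measure_of_isPiSystem_of_isProbabilityMeasure
      (Solenoid.generateFrom_coordSets N) (Solenoid.isPiSystem_coordSets N) ?_
    rintro _ ⟨n, B, hB, rfl⟩
    have hind : Measurable ((circleParam ⁻¹' B).indicator (1 : ℝ → ℝ≥0∞)) :=
      measurable_one.indicator (continuous_circleParam.measurable hB)
    have : (fun x => κ x ((fun z : Solenoid N => z.1 n) ⁻¹' B)) = fun x => if x ∈ T then
        (walkMeasure N (filterWeight N m₀) 0).map (solenoidPath N 0)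
          ((fun z : Solenoid N => z.1 n) ⁻¹' B)
        else (branchTransfer N (filterWeight N w))^[n] ((circleParam ⁻¹' B).indicator 1) x := by
      ext x
      simp only [κ]
      split_ifs with h
      · rfl
      · rw [walkMeasure_map_solenoidPath_coord _ _ _ hB, hgood x h]
    rw [this]
    exact Measurable.ite hT measurable_const (measurable_branchTransfer_iterate N
      (measurable_filterWeight N hw.measurable) hind n)
  · filter_upwards [measure_eq_zero_iff_ae_notMem.1 hT0] with x hx
    simp only [κ, if_neg hx]

theorem filterMeasure_apply (hm : AEStronglyMeasurable m₀ circleMeasure)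
    (hR : ruelle N m₀ (fun _ => 1) =ᵐ[circleMeasure] fun _ => 1) {E : Set (Solenoid N)}
    (hE : MeasurableSet E) :
    filterMeasure N m₀ E =
      ∫⁻ x, walkMeasure N (filterWeight N m₀) x {ω | solenoidPath N x ω ∈ E} ∂lebesgueIco := by
  unfold filterMeasure solenoidMeasure
  rw [Measure.bind_apply hE (aemeasurable_walkMeasure_map hm hR)]
  refine lintegral_congr fun x => ?_
  rw [Measure.map_apply (measurable_solenoidPath N x) hE]
  rfl

theorem isProbabilityMeasure_filterMeasure (hm : AEStronglyMeasurable m₀ circleMeasure)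
    (hR : ruelle N m₀ (fun _ => 1) =ᵐ[circleMeasure] fun _ => 1) :
    IsProbabilityMeasure (filterMeasure N m₀) :=
  ⟨by simp [filterMeasure_apply hm hR MeasurableSet.univ]⟩

/-- The law of the `n`-th coordinate under the random-walk measure. -/
theorem filterMeasure_map_coord (hm : AEStronglyMeasurable m₀ circleMeasure)
    (hR : ruelle N m₀ (fun _ => 1) =ᵐ[circleMeasure] fun _ => 1) {w : Circle → ℂ}
    (hw : Measurable w) (hmw : m₀ =ᵐ[circleMeasure] w) (n : ℕ) :
    (filterMeasure N m₀).map (fun z => z.1 n) = circleMeasure.withDensity (filterDensity N w n) := by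
  ext B hB
  have hc := continuous_circleParam.measurable
  have hind : Measurable ((circleParam ⁻¹' B).indicator (1 : ℝ → ℝ≥0∞)) :=
    measurable_one.indicator (hc hB)
  rw [Measure.map_apply (Solenoid.measurable_coord N n) hB, filterMeasure, solenoidMeasure,
    Measure.bind_apply (Solenoid.measurable_coord N n hB) (aemeasurable_walkMeasure_map hm hR),
    withDensity_apply _ hB, ← lintegral_indicator hB,
    ← measurePreserving_circleParam.lintegral_comp
      ((measurable_filterDensity N hw n).indicator hB)]
  trans ∫⁻ x, (branchTransfer N (filterWeight N w))^[n] ((circleParam ⁻¹' B).indicator 1) x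
    ∂lebesgueIco
  · refine lintegral_congr_ae ?_
    filter_upwards [ae_lintegral_walkPos hR hmw] with x hx
    rw [walkMeasure_map_solenoidPath_coord _ _ _ hB, hx]
  · rw [lintegral_branchTransfer_iterate N hw hind]
    refine lintegral_congr fun x => ?_
    by_cases hx : circleParam x ∈ B
    · simp [hx]
    · simp [hx]

theorem measurePreserving_coord_zero (hm : AEStronglyMeasurable m₀ circleMeasure)
    (hR : ruelle N m₀ (fun _ => 1) =ᵐ[circleMeasure] fun _ => 1) :
    MeasurePreserving (fun z : Solenoid N => z.1 0) (filterMeasure N m₀) circleMeasure := by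
  obtain ⟨w, hw, hmw⟩ := id hm
  refine ⟨Solenoid.measurable_coord N 0, ?_⟩
  rw [filterMeasure_map_coord hm hR hw.measurable hmw 0]
  have : filterDensity N w 0 = 1 := by
    ext z
    simp [filterDensity]
  rw [this, withDensity_one]

/-- The Radon-Nikodym property of the random-walk measure under the shift. -/
theorem filterMeasure_map_shift_symm (hm : AEStronglyMeasurable m₀ circleMeasure)
    (hR : ruelle N m₀ (fun _ => 1) =ᵐ[circleMeasure] fun _ => 1) :
    (filterMeasure N m₀).map (shift N).symm =
      (filterMeasure N m₀).withDensity fun z => ‖m₀ (z.1 0)‖ₑ ^ 2 := by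
  obtain ⟨w, hw, hmw⟩ := id hm
  have hcongr : (filterMeasure N m₀).withDensity (fun z => ‖m₀ (z.1 0)‖ₑ ^ 2) =
      (filterMeasure N m₀).withDensity fun z => ‖w (z.1 0)‖ₑ ^ 2 := by
    refine withDensity_congr_ae ?_
    filter_upwards [(measurePreserving_coord_zero hm hR).quasiMeasurePreserving.ae hmw] with z hz
    rw [hz]
  have hsymm := measurable_shift_symm N
  have hw0 : ∀ n, Measurable fun z : Circle => ‖w (z ^ N ^ n)‖ₑ ^ 2 := fun n =>
    (hw.measurable.comp (continuous_pow _).measurable).enorm.pow_const 2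
  rw [hcongr]
  refine Solenoid.measure_ext fun n => ?_
  rw [Measure.map_map (Solenoid.measurable_coord N n) hsymm]
  -- Coordinate n of S⁻¹ z is z_{n+1}.
  change (filterMeasure N m₀).map (fun z => z.1 (n + 1)) = _
  rw [filterMeasure_map_coord hm hR hw.measurable hmw]
  have hmc := Solenoid.measurable_coord N n
  ext B hB
  rw [Measure.map_apply hmc hB, withDensity_apply _ hB, withDensity_apply _ (hmc hB)]
  -- Written through z_n, the weight passes to the law of z_n and supplies exactly the last factor
  -- of the density of z_{n+1}.
  have e1 : ∀ z : Solenoid N, ‖w (z.1 0)‖ₑ ^ 2 = ‖w (z.1 n ^ N ^ n)‖ₑ ^ 2 := fun z => by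
    have := z.coord_add_pow 0 n
    rw [zero_add] at this
    rw [this]
  simp only [e1]
  rw [← setLIntegral_map hB (hw0 n) hmc, filterMeasure_map_coord hm hR hw.measurable hmw,
    setLIntegral_withDensity_eq_setLIntegral_mul _ (measurable_filterDensity N hw.measurable n)
      (hw0 n) hB]
  refine lintegral_congr fun z => ?_
  rw [filterDensity_succ, Pi.mul_apply]

end FilterMeasure

/-! ## Words in the Baumslag-Solitar group -/

theorem pow_mul_zpow_of_conj {G : Type*} [Group G] {a b : G} {N : ℕ} (h : a * b * a⁻¹ = b ^ N)
    (n : ℕ) (k : ℤ) : a ^ n * b ^ k = b ^ ((N : ℤ) ^ n * k) * a ^ n := by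
  have h1 : ∀ k : ℤ, a * b ^ k = b ^ ((N : ℤ) * k) * a := fun k => by
    rw [zpow_mul, zpow_natCast, ← h, conj_zpow, inv_mul_cancel_right]
  induction n generalizing k with
  | zero => simp
  | succ n ih =>
    rw [pow_succ, mul_assoc, h1, ← mul_assoc, ih, mul_assoc, pow_succ (N : ℤ), mul_assoc]

namespace BaumslagSolitar

variable (N : ℕ)

theorem u_mul_t_mul_inv : u N * t N * (u N)⁻¹ = t N ^ N :=
  mul_inv_eq_one.1 (PresentedGroup.one_of_mem (Set.mem_singleton _))

theorem exists_monoidHom {G : Type*} [Group G] {a b : G} (h : a * b * a⁻¹ = b ^ N) :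
    ∃ ρ : BaumslagSolitar N →* G, ρ (u N) = a ∧ ρ (t N) = b := by
  have hrel : ∀ r ∈ ({FreeGroup.of 0 * FreeGroup.of 1 * (FreeGroup.of 0)⁻¹ *
      (FreeGroup.of 1 ^ N)⁻¹} : Set (FreeGroup (Fin 2))), FreeGroup.lift ![a, b] r = 1 := by
    rintro _ rfl
    simp [h]
  exact ⟨PresentedGroup.toGroup hrel, PresentedGroup.toGroup.of hrel,
    PresentedGroup.toGroup.of hrel⟩

theorem closure_eq_top : Subgroup.closure {u N, t N} = ⊤ := by
  rw [← PresentedGroup.closure_range_of]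
  congr 1
  ext g
  simp only [Set.mem_insert_iff, Set.mem_singleton_iff, Set.mem_range, Fin.exists_fin_two]
  exact or_congr eq_comm eq_comm

/-- The set of such words is stable under left multiplication by u^{±1} and t^{±1}: t^j u⁻ⁿ = u⁻ⁿ
t^{N^n j}, and u either cancels a factor u⁻¹ or, when n = 0, moves past t^k as t^{Nk} u. -/
theorem exists_eq_word (g : BaumslagSolitar N) :
    ∃ (n m : ℕ) (k : ℤ), g = (u N ^ n)⁻¹ * t N ^ k * u N ^ m := by
  have hg : g ∈ Subgroup.closure {u N, t N} := closure_eq_top N ▸ Subgroup.mem_top g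
  have hc := pow_mul_zpow_of_conj (u_mul_t_mul_inv N)
  have hpow : ∀ (n m : ℕ) (k j : ℤ), t N ^ j * ((u N ^ n)⁻¹ * t N ^ k * u N ^ m) =
      (u N ^ n)⁻¹ * t N ^ ((N : ℤ) ^ n * j + k) * u N ^ m := fun n m k j => by
    have h1 : t N ^ j * (u N ^ n)⁻¹ = (u N ^ n)⁻¹ * t N ^ ((N : ℤ) ^ n * j) := by
      rw [eq_inv_mul_iff_mul_eq, ← mul_assoc, hc, mul_inv_cancel_right]
    rw [zpow_add, ← mul_assoc, ← mul_assoc, h1]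
    simp only [mul_assoc]
  induction hg using Subgroup.closure_induction_left with
  | one => exact ⟨0, 0, 0, by simp⟩
  | mul_left x hx y _ ih =>
    obtain ⟨n, m, k, rfl⟩ := ih
    rcases hx with rfl | rfl
    · cases n with
      | zero =>
        refine ⟨0, m + 1, N * k, ?_⟩
        have := hc 1 k
        simp only [pow_one] at this
        rw [pow_zero, inv_one, one_mul, one_mul, ← mul_assoc, this, mul_assoc, pow_succ']
      | succ n =>
        refine ⟨n, m, k, ?_⟩
        rw [pow_succ, mul_inv_rev]
        simp only [← mul_assoc, mul_inv_cancel, one_mul]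
    · exact ⟨n, m, _, by simpa using hpow n m k 1⟩
  | inv_mul_cancel x hx y _ ih =>
    obtain ⟨n, m, k, rfl⟩ := ih
    rcases hx with rfl | rfl
    · refine ⟨n + 1, m, k, ?_⟩
      rw [pow_succ, mul_inv_rev]
      simp only [← mul_assoc]
    · exact ⟨n, m, _, by simpa using hpow n m k (-1)⟩

end BaumslagSolitar

/-! ## Fourier analysis on the circle -/

/-- The characters of the circle. -/
def circleCharacter (k : ℤ) : C(Circle, ℂ) := ⟨fun z => ((z ^ k : Circle) : ℂ), (by fun_prop : Continuous fun z : Circle => (z : ℂ)).comp (continuous_zpow k)⟩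

theorem circleCharacter_one : ∃ k, circleCharacter k = 1 :=
  ⟨0, by ext z; simp [circleCharacter]⟩

theorem circleCharacter_mul (k l : ℤ) :
    ∃ j, circleCharacter j = circleCharacter k * circleCharacter l :=
  ⟨k + l, by ext z; simp [circleCharacter, zpow_add]⟩

theorem circleCharacter_star (k : ℤ) : ∃ j, circleCharacter j = star (circleCharacter k) :=
  ⟨-k, by ext z; simp [circleCharacter, ← Circle.coe_inv_eq_conj]⟩

theorem circleCharacter_separates (z w : Circle) (h : z ≠ w) :
    ∃ k, circleCharacter k z ≠ circleCharacter k w :=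
  ⟨1, by simpa [circleCharacter] using fun e => h (Circle.ext e)⟩

/-- The characters as vectors of `L²` of the circle. -/
def fourierVector (k : ℤ) : Lp ℂ 2 circleMeasure :=
  ContinuousMap.toLp 2 circleMeasure ℂ (circleCharacter k)

theorem fourierVector_coeFn (k : ℤ) :
    fourierVector k =ᵐ[circleMeasure] fun z => ((z ^ k : Circle) : ℂ) :=
  ContinuousMap.coeFn_toLp circleMeasure (circleCharacter k)

theorem dense_span_fourierVector :
    Dense (Submodule.span ℂ (Set.range fourierVector) : Set (Lp ℂ 2 circleMeasure)) :=
  dense_span_toLp_of_characters circleMeasure circleCharacter_one circleCharacter_mul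
    circleCharacter_star circleCharacter_separates

theorem Lp.inner_eq_integral_mul_conj {X : Type*} [MeasurableSpace X] {ν : Measure X}
    (f g : Lp ℂ 2 ν) : inner ℂ f g = ∫ x, g x * (starRingEnd ℂ) (f x) ∂ν := by
  rw [L2.inner_def]
  simp only [RCLike.inner_apply]

/-- The moments are all the Fourier coefficients of an L¹ function. Consequently `IsBorelCalculus`
can be verified on one correlation function for each pair of vectors. -/
theorem IsCorrelation.ae_eq {H : Type*} [NormedAddCommGroup H] [InnerProductSpace ℂ H]
    {T : H ≃ₗᵢ[ℂ] H} {v w : H} {h h' : Circle → ℂ} (hh : IsCorrelation T v w h)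
    (hh' : IsCorrelation T v w h') : h =ᵐ[circleMeasure] h' := by
  have hint : ∀ (k : ℤ) {f : Circle → ℂ}, Integrable f circleMeasure →
      Integrable (fun z => ((z ^ k : Circle) : ℂ) * f z) circleMeasure := fun k f hf =>
    hf.bdd_mul (c := 1) (circleCharacter k).continuous.aestronglyMeasurable
      (Filter.Eventually.of_forall fun z => (Circle.norm_coe _).le)
  have h0 := ae_eq_zero_of_integral_characters_mul_eq_zero circleMeasure circleCharacter_one
    circleCharacter_mul circleCharacter_star circleCharacter_separates
    (hh.integrable.sub hh'.integrable) (fun k => by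
      have : ∀ z, circleCharacter k z * (h - h') z =
          ((z ^ k : Circle) : ℂ) * h z - ((z ^ k : Circle) : ℂ) * h' z := fun z => mul_sub _ _ _
      simp only [this]
      rw [integral_sub (hint k hh.integrable) (hint k hh'.integrable), ← hh.moment, ← hh'.moment,
        sub_self])
  filter_upwards [h0] with z hz
  exact sub_eq_zero.1 hz

/-! ## Powers of multiplication operators and intertwiners -/

theorem zpow_ae_eq_mul {X : Type*} [MeasurableSpace X] {ν : Measure X}
    {T : Lp ℂ 2 ν ≃ₗᵢ[ℂ] Lp ℂ 2 ν} {c : X → Circle}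
    (h : ∀ ξ, T ξ =ᵐ[ν] fun x => (c x : ℂ) * ξ x) (k : ℤ) (ξ : Lp ℂ 2 ν) :
    (T ^ k) ξ =ᵐ[ν] fun x => ((c x ^ k : Circle) : ℂ) * ξ x := by
  have hnat : ∀ (n : ℕ) (ξ : Lp ℂ 2 ν),
      (T ^ n) ξ =ᵐ[ν] fun x => ((c x ^ n : Circle) : ℂ) * ξ x := by
    intro n
    induction n with
    | zero => intro ξ; simp
    | succ n ih =>
      intro ξ
      rw [pow_succ]
      filter_upwards [ih (T ξ), h ξ] with x h1 h2
      change ((T ^ n) (T ξ)) x = _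
      rw [h1, h2, pow_succ, Circle.coe_mul, mul_assoc]
  obtain ⟨n, rfl | rfl⟩ := k.eq_nat_or_neg
  · simpa using hnat n ξ
  · have h2 : (T ^ n) ((T ^ (-(n : ℤ))) ξ) = ξ := by
      rw [zpow_neg, zpow_natCast]
      exact (T ^ n).apply_symm_apply ξ
    have h1 := hnat n ((T ^ (-(n : ℤ))) ξ)
    rw [h2] at h1
    filter_upwards [h1] with x hx
    rw [hx, ← mul_assoc, ← Circle.coe_mul]
    simp

theorem intertwines_zpow {E F : Type*} [NormedAddCommGroup E] [InnerProductSpace ℂ E]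
    [NormedAddCommGroup F] [InnerProductSpace ℂ F] {J : E → F} {M : E ≃ₗᵢ[ℂ] E}
    {T : F ≃ₗᵢ[ℂ] F} (h : ∀ f, J (M f) = T (J f)) (k : ℤ) (f : E) :
    J ((M ^ k) f) = (T ^ k) (J f) := by
  have hnat : ∀ (n : ℕ) (f : E), J ((M ^ n) f) = (T ^ n) (J f) := by
    intro n
    induction n with
    | zero => intro f; rfl
    | succ n ih =>
      intro f
      rw [pow_succ, pow_succ]
      change J ((M ^ n) (M f)) = (T ^ n) (T (J f))
      rw [ih, h]
  obtain ⟨n, rfl | rfl⟩ := k.eq_nat_or_neg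
  · simpa using hnat n f
  · have h1 := hnat n ((M ^ (-(n : ℤ))) f)
    have h2 : (M ^ n) ((M ^ (-(n : ℤ))) f) = f := by
      rw [zpow_neg, zpow_natCast]
      exact (M ^ n).apply_symm_apply f
    rw [h2] at h1
    rw [h1, zpow_neg T, zpow_natCast]
    exact ((T ^ n).symm_apply_apply (J ((M ^ (-(n : ℤ))) f))).symm

theorem exists_mul_coord : ∃ M : Lp ℂ 2 circleMeasure ≃ₗᵢ[ℂ] Lp ℂ 2 circleMeasure,
    ∀ f, M f =ᵐ[circleMeasure] fun z => (z : ℂ) * f z := by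
  refine exists_linearIsometryEquiv_mul_comp (MeasurableEquiv.refl _)
    (c := fun z : Circle => (z : ℂ)) (by fun_prop : Continuous fun z : Circle => (z : ℂ)).aestronglyMeasurable
    (Filter.Eventually.of_forall fun z => Circle.coe_ne_zero z) ?_
  have : ∀ z : Circle, ‖(z : ℂ)‖ₑ ^ 2 = 1 := fun z => by
    rw [← ofReal_norm, Circle.norm_coe, ENNReal.ofReal_one, one_pow]
  simp only [this]
  exact Measure.map_id.trans withDensity_one.symm

/-! ## The cyclic subspace of a wavelet representation -/

section WaveletRepresentation

variable {H : Type*} [NormedAddCommGroup H] [InnerProductSpace ℂ H] {N : ℕ}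
  {m₀ : Circle → ℂ} {ρ : BaumslagSolitar N →* (H ≃ₗᵢ[ℂ] H)} {φ : H}

theorem inner_zpow_apply (T : H ≃ₗᵢ[ℂ] H) (v : H) (k l : ℤ) :
    inner ℂ ((T ^ k) v) ((T ^ l) v) = inner ℂ v ((T ^ (l - k)) v) := by
  rw [← (T ^ k).inner_map_map v ((T ^ (l - k)) v)]
  change _ = inner ℂ _ ((T ^ k * T ^ (l - k)) v)
  rw [← zpow_add, add_sub_cancel]

theorem inner_fourierVector (k l : ℤ) :
    inner ℂ (fourierVector k) (fourierVector l) =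
      ∫ z, (((z ^ (l - k) : Circle) : ℂ)) * 1 ∂circleMeasure := by
  rw [Lp.inner_eq_integral_mul_conj]
  refine integral_congr_ae ?_
  filter_upwards [fourierVector_coeFn k, fourierVector_coeFn l] with z h1 h2
  rw [h1, h2, ← Circle.coe_inv_eq_conj, ← Circle.coe_mul, zpow_sub, mul_one]

/-- For h = 1 the vectors T^k φ have the Gram matrix of the characters in L²(𝕋). The isometry plays
the role of f ↦ π(f)φ. -/
theorem IsWaveletRepresentation.exists_linearIsometry [CompleteSpace H]
    (h : IsWaveletRepresentation N m₀ (fun _ => 1) ρ φ) :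
    ∃ J : Lp ℂ 2 circleMeasure →ₗᵢ[ℂ] H, ∀ k, J (fourierVector k) =
      (ρ (BaumslagSolitar.t N) ^ k) φ :=
  exists_linearIsometry_of_inner_eq dense_span_fourierVector fun k l => by
    rw [inner_fourierVector, inner_zpow_apply, h.correlation.moment]

variable {M : Lp ℂ 2 circleMeasure ≃ₗᵢ[ℂ] Lp ℂ 2 circleMeasure}
  {R : Lp ℂ 2 circleMeasure →ₗᵢ[ℂ] Lp ℂ 2 circleMeasure}

theorem mul_coord_fourierVector (hM : ∀ f, M f =ᵐ[circleMeasure] fun z => (z : ℂ) * f z) (k : ℤ) :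
    M (fourierVector k) = fourierVector (k + 1) := by
  refine Lp.ext ?_
  filter_upwards [hM (fourierVector k), fourierVector_coeFn k, fourierVector_coeFn (k + 1)]
    with z h1 h2 h3
  rw [h1, h2, h3, ← Circle.coe_mul, zpow_add_one, mul_comm]

theorem map_mul_coord (hM : ∀ f, M f =ᵐ[circleMeasure] fun z => (z : ℂ) * f z) {T : H ≃ₗᵢ[ℂ] H}
    {J : Lp ℂ 2 circleMeasure →ₗᵢ[ℂ] H} (hJ : ∀ k, J (fourierVector k) = (T ^ k) φ)
    (f : Lp ℂ 2 circleMeasure) : J (M f) = T (J f) := by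
  have : J.toContinuousLinearMap.comp (M : Lp ℂ 2 circleMeasure →L[ℂ] Lp ℂ 2 circleMeasure) =
      (T : H →L[ℂ] H).comp J.toContinuousLinearMap := by
    refine ContinuousLinearMap.ext_on dense_span_fourierVector ?_
    rintro _ ⟨k, rfl⟩
    change J (M (fourierVector k)) = T (J (fourierVector k))
    rw [mul_coord_fourierVector hM, hJ, hJ, add_comm, zpow_one_add]
    rfl
  exact congrArg (fun L : Lp ℂ 2 circleMeasure →L[ℂ] H => L f) this

/-- With η = J*w, the conjugate of η is a correlation function of φ and w, so pairing A φ with w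
gives the L²(𝕋) pairing of m₀ with η. -/
theorem apply_eq_of_isBorelCalculus [CompleteSpace H] {T : H ≃ₗᵢ[ℂ] H} {A : H →L[ℂ] H}
    (hA : IsBorelCalculus T m₀ A) {J : Lp ℂ 2 circleMeasure →ₗᵢ[ℂ] H}
    (hJ : ∀ k, J (fourierVector k) = (T ^ k) φ) {f : Lp ℂ 2 circleMeasure}
    (hf : f =ᵐ[circleMeasure] m₀) : A φ = J f := by
  refine ext_inner_left ℂ fun w => ?_
  set η := ContinuousLinearMap.adjoint J.toContinuousLinearMap w
  have hη : ∀ f, inner ℂ w (J f) = inner ℂ η f := fun f =>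
    (ContinuousLinearMap.adjoint_inner_left J.toContinuousLinearMap f w).symm
  have hcorr : IsCorrelation T φ w fun z => (starRingEnd ℂ) (η z) := by
    refine ⟨?_, fun k => ?_⟩
    · exact ((Lp.memLp η).star.mono_exponent (by norm_num : (1 : ℝ≥0∞) ≤ 2)).integrable le_rfl
    · rw [← hJ, hη, Lp.inner_eq_integral_mul_conj]
      refine integral_congr_ae ?_
      filter_upwards [fourierVector_coeFn k] with z hz
      rw [hz]
  rw [hA φ w _ hcorr, hη, Lp.inner_eq_integral_mul_conj]
  refine integral_congr_ae ?_
  filter_upwards [hf] with z hz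
  rw [hz]

/-- On characters, U T^k φ = T^{Nk} U φ = T^{Nk} J(m₀) = J(m₀ z^{Nk}), by the group relation and the
scaling equation; density does the rest. -/
theorem IsWaveletRepresentation.u_apply_linearIsometry [CompleteSpace H]
    (h : IsWaveletRepresentation N m₀ (fun _ => 1) ρ φ)
    (hM : ∀ f, M f =ᵐ[circleMeasure] fun z => (z : ℂ) * f z)
    (hR : ∀ f, R f =ᵐ[circleMeasure] fun z => m₀ z * f (z ^ N))
    (hq : Measure.QuasiMeasurePreserving (fun z : Circle => z ^ N) circleMeasure circleMeasure)
    {J : Lp ℂ 2 circleMeasure →ₗᵢ[ℂ] H}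
    (hJ : ∀ k, J (fourierVector k) = (ρ (BaumslagSolitar.t N) ^ k) φ)
    (f : Lp ℂ 2 circleMeasure) : ρ (BaumslagSolitar.u N) (J f) = J (R f) := by
  set U := ρ (BaumslagSolitar.u N)
  set T := ρ (BaumslagSolitar.t N)
  have hrel : U * T * U⁻¹ = T ^ N := by
    simp only [U, T, ← map_mul, ← map_inv, ← map_pow, BaumslagSolitar.u_mul_t_mul_inv]
  have hJT : ∀ f, J (M f) = T (J f) := map_mul_coord hM hJ
  have hR0 : ∀ k : ℤ, R (fourierVector k) = (M ^ ((N : ℤ) * k)) (R (fourierVector 0)) := by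
    intro k
    refine Lp.ext ?_
    filter_upwards [hR (fourierVector k), hR (fourierVector 0), hq.ae (fourierVector_coeFn k),
      hq.ae (fourierVector_coeFn 0), zpow_ae_eq_mul (c := id) hM ((N : ℤ) * k)
        (R (fourierVector 0))] with z h1 h2 h3 h4 h5
    rw [h1, h5, h2, h3, h4, zpow_mul]
    simp [mul_comm]
  obtain ⟨A, hA, hUA⟩ := h.scaling
  have hφ : U φ = J (R (fourierVector 0)) := by
    rw [hUA]
    refine apply_eq_of_isBorelCalculus hA hJ ?_
    filter_upwards [hR (fourierVector 0), hq.ae (fourierVector_coeFn 0)] with z h1 h2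
    rw [h1, h2]
    simp
  have : (U : H →L[ℂ] H).comp J.toContinuousLinearMap =
      J.toContinuousLinearMap.comp R.toContinuousLinearMap := by
    refine ContinuousLinearMap.ext_on dense_span_fourierVector ?_
    rintro _ ⟨k, rfl⟩
    change U (J (fourierVector k)) = J (R (fourierVector k))
    rw [hR0, intertwines_zpow hJT, ← hφ, hJ]
    have := pow_mul_zpow_of_conj hrel 1 k
    simp only [pow_one] at this
    exact congrArg (fun L : H ≃ₗᵢ[ℂ] H => L φ) this
  exact congrArg (fun L : Lp ℂ 2 circleMeasure →L[ℂ] H => L f) this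

/-- The coefficients of a wavelet representation at its cyclic vector are determined by `m₀`. -/
theorem IsWaveletRepresentation.inner_word [CompleteSpace H]
    (h : IsWaveletRepresentation N m₀ (fun _ => 1) ρ φ)
    (hM : ∀ f, M f =ᵐ[circleMeasure] fun z => (z : ℂ) * f z)
    (hR : ∀ f, R f =ᵐ[circleMeasure] fun z => m₀ z * f (z ^ N))
    (hq : Measure.QuasiMeasurePreserving (fun z : Circle => z ^ N) circleMeasure circleMeasure)
    (n m : ℕ) (k : ℤ) :
    inner ℂ φ (ρ ((BaumslagSolitar.u N ^ n)⁻¹ * BaumslagSolitar.t N ^ k *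
      BaumslagSolitar.u N ^ m) φ) =
        inner ℂ ((R ^ n) (fourierVector 0)) ((M ^ k) ((R ^ m) (fourierVector 0))) := by
  obtain ⟨J, hJ⟩ := h.exists_linearIsometry
  have hU := h.u_apply_linearIsometry hM hR hq hJ
  have hpow : ∀ (n : ℕ) (f : Lp ℂ 2 circleMeasure),
      (ρ (BaumslagSolitar.u N) ^ n) (J f) = J ((R ^ n) f) := by
    intro n
    induction n with
    | zero => intro f; rfl
    | succ n ih =>
      intro f
      rw [pow_succ, pow_succ]
      change (ρ (BaumslagSolitar.u N) ^ n) (ρ (BaumslagSolitar.u N) (J f)) = J ((R ^ n) (R f))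
      rw [hU, ih]
  have hφ : φ = J (fourierVector 0) := by
    rw [hJ, zpow_zero]
    rfl
  have hx : ρ ((BaumslagSolitar.u N ^ n)⁻¹ * BaumslagSolitar.t N ^ k *
      BaumslagSolitar.u N ^ m) φ = (ρ (BaumslagSolitar.u N) ^ n).symm
        ((ρ (BaumslagSolitar.t N) ^ k) ((ρ (BaumslagSolitar.u N) ^ m) φ)) := by
    rw [map_mul, map_mul, map_inv, map_pow, map_zpow, map_pow]
    rfl
  rw [hx, ← (ρ (BaumslagSolitar.u N) ^ n).inner_map_map, LinearIsometryEquiv.apply_symm_apply]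
  conv_lhs => rw [hφ]
  rw [hpow, hpow, ← intertwines_zpow (map_mul_coord hM hJ), J.inner_map_map]

/-- By unitarity the Gram matrix of an orbit depends only on g₁⁻¹g₂, and on words `inner_word`
evaluates it in L²(𝕋) by a formula common to both representations. -/
theorem IsWaveletRepresentation.exists_intertwiner [CompleteSpace H]
    {K : Type*} [NormedAddCommGroup K] [InnerProductSpace ℂ K] [CompleteSpace K]
    {ρ' : BaumslagSolitar N →* (K ≃ₗᵢ[ℂ] K)} {ψ : K}
    (h : IsWaveletRepresentation N m₀ (fun _ => 1) ρ φ)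
    (h' : IsWaveletRepresentation N m₀ (fun _ => 1) ρ' ψ)
    (hR : ∀ f, R f =ᵐ[circleMeasure] fun z => m₀ z * f (z ^ N))
    (hq : Measure.QuasiMeasurePreserving (fun z : Circle => z ^ N) circleMeasure circleMeasure) :
    ∃ V : H ≃ₗᵢ[ℂ] K, V φ = ψ ∧ ∀ g v, V (ρ g v) = ρ' g (V v) := by
  obtain ⟨M, hM⟩ := exists_mul_coord
  have hinner : ∀ (g₁ g₂ : BaumslagSolitar N), inner ℂ (ρ g₁ φ) (ρ g₂ φ) =
      inner ℂ (ρ' g₁ ψ) (ρ' g₂ ψ) := by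
    intro g₁ g₂
    obtain ⟨n, m, k, hg⟩ := BaumslagSolitar.exists_eq_word N (g₁⁻¹ * g₂)
    have e1 : ρ g₂ φ = ρ g₁ (ρ (g₁⁻¹ * g₂) φ) := by
      change _ = (ρ g₁ * ρ (g₁⁻¹ * g₂)) φ
      rw [← map_mul, mul_inv_cancel_left]
    have e2 : ρ' g₂ ψ = ρ' g₁ (ρ' (g₁⁻¹ * g₂) ψ) := by
      change _ = (ρ' g₁ * ρ' (g₁⁻¹ * g₂)) ψ
      rw [← map_mul, mul_inv_cancel_left]
    rw [e1, e2, LinearIsometryEquiv.inner_map_map, LinearIsometryEquiv.inner_map_map, hg,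
      h.inner_word hM hR hq, h'.inner_word hM hR hq]
  obtain ⟨V, hV⟩ := exists_linearIsometryEquiv_of_inner_eq h.cyclic h'.cyclic hinner
  refine ⟨V, by simpa using hV 1, fun g v => ?_⟩
  have : (V : H →L[ℂ] K).comp (ρ g : H →L[ℂ] H) = (ρ' g : K →L[ℂ] K).comp (V : H →L[ℂ] K) := by
    refine ContinuousLinearMap.ext_on h.cyclic ?_
    rintro _ ⟨g', rfl⟩
    change V (ρ g (ρ g' φ)) = ρ' g (V (ρ g' φ))
    rw [hV]
    change V ((ρ g * ρ g') φ) = (ρ' g * ρ' g') ψ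
    rw [← map_mul, ← map_mul, hV]
  exact congrArg (fun L : H →L[ℂ] K => L v) this

end WaveletRepresentation

/-! ## Characters of the solenoid -/

theorem isCompact_setOf_solenoid (N : ℕ) :
    IsCompact {z : ℕ → Circle | ∀ n, z (n + 1) ^ N = z n} := by
  refine IsClosed.isCompact ?_
  rw [Set.ofPred_forall]
  exact isClosed_iInter fun n => isClosed_eq (by fun_prop) (by fun_prop)

instance (N : ℕ) : CompactSpace (Solenoid N) :=
  isCompact_iff_compactSpace.1 (isCompact_setOf_solenoid N)

theorem Solenoid.continuous_coord (N n : ℕ) : Continuous fun z : Solenoid N => z.1 n :=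
  (continuous_apply n).comp continuous_subtype_val

/-- The characters `z_n^k` of the solenoid. -/
def solenoidCharacter (N : ℕ) (p : ℕ × ℤ) : C(Solenoid N, ℂ) :=
  (circleCharacter p.2).comp ⟨fun z => z.1 p.1, Solenoid.continuous_coord N p.1⟩

theorem solenoidCharacter_apply {N : ℕ} (p : ℕ × ℤ) (z : Solenoid N) :
    solenoidCharacter N p z = ((z.1 p.1 ^ p.2 : Circle) : ℂ) := rfl

theorem solenoidCharacter_one (N : ℕ) : ∃ p, solenoidCharacter N p = 1 :=
  ⟨(0, 0), by ext z; simp [solenoidCharacter_apply]⟩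

theorem solenoidCharacter_mul (N : ℕ) (p q : ℕ × ℤ) :
    ∃ r, solenoidCharacter N r = solenoidCharacter N p * solenoidCharacter N q := by
  -- Both factors become powers of the common later coordinate of index p.1 + q.1.
  refine ⟨(p.1 + q.1, (N : ℤ) ^ q.1 * p.2 + (N : ℤ) ^ p.1 * q.2), ?_⟩
  ext z
  rw [ContinuousMap.mul_apply, solenoidCharacter_apply, solenoidCharacter_apply,
    solenoidCharacter_apply, ← Circle.coe_mul]
  congr 1
  rw [← z.coord_add_pow p.1 q.1, ← z.coord_add_pow q.1 p.1, add_comm q.1, zpow_add, zpow_mul,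
    zpow_mul]
  norm_cast

theorem solenoidCharacter_star (N : ℕ) (p : ℕ × ℤ) :
    ∃ q, solenoidCharacter N q = star (solenoidCharacter N p) := by
  refine ⟨(p.1, -p.2), ?_⟩
  ext z
  rw [ContinuousMap.star_apply, solenoidCharacter_apply, solenoidCharacter_apply, zpow_neg,
    Circle.coe_inv_eq_conj]
  rfl

theorem solenoidCharacter_separates (N : ℕ) (z w : Solenoid N) (h : z ≠ w) :
    ∃ p, solenoidCharacter N p z ≠ solenoidCharacter N p w := by
  by_contra! hall
  refine h (Subtype.ext (funext fun n => Circle.ext ?_))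
  simpa [solenoidCharacter_apply] using hall (n, 1)

theorem dense_span_solenoidCharacter {N : ℕ} (ν : Measure (Solenoid N)) [IsFiniteMeasure ν] :
    Dense (Submodule.span ℂ (Set.range fun p => ContinuousMap.toLp 2 ν ℂ (solenoidCharacter N p)) :
      Set (Lp ℂ 2 ν)) :=
  -- Metrizability makes the finite measure weakly regular, as the density of C in L² requires.
  have : SecondCountableTopology (Solenoid N) := TopologicalSpace.Subtype.secondCountableTopology _
  have : TopologicalSpace.MetrizableSpace (Solenoid N) :=
    TopologicalSpace.metrizableSpace_of_t3_secondCountable _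
  dense_span_toLp_of_characters ν (solenoidCharacter_one N) (solenoidCharacter_mul N)
    (solenoidCharacter_star N) (solenoidCharacter_separates N)

/-! ## The representation on `L²` of the solenoid -/

section Solenoid

variable {N : ℕ} {ν : Measure (Solenoid N)}
  {c : Solenoid N → ℂ} {ρ : BaumslagSolitar N →* (Lp ℂ 2 ν ≃ₗᵢ[ℂ] Lp ℂ 2 ν)}

theorem exists_solenoid_mul_coord (n : ℕ) : ∃ M : Lp ℂ 2 ν ≃ₗᵢ[ℂ] Lp ℂ 2 ν,
    ∀ f, M f =ᵐ[ν] fun z => (z.1 n : ℂ) * f z := by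
  have hc : Continuous fun z : Solenoid N => (z.1 n : ℂ) :=
    (by fun_prop : Continuous fun z : Circle => (z : ℂ)).comp (Solenoid.continuous_coord N n)
  refine exists_linearIsometryEquiv_mul_comp (MeasurableEquiv.refl _)
    (c := fun z : Solenoid N => (z.1 n : ℂ)) hc.aestronglyMeasurable
    (Filter.Eventually.of_forall fun z => Circle.coe_ne_zero _) ?_
  have : ∀ z : Solenoid N, ‖(z.1 n : ℂ)‖ₑ ^ 2 = 1 := fun z => by
    rw [← ofReal_norm, Circle.norm_coe, ENNReal.ofReal_one, one_pow]
  simp only [this]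
  exact Measure.map_id.trans withDensity_one.symm

/-- The relation U T = T^N U holds because the symbol z_0 of T composed with S is z_0^N. -/
theorem exists_solenoid_representation (hc : AEStronglyMeasurable c ν)
    (hc0 : ∀ᵐ z ∂ν, c z ≠ 0) (h : ν.map (shift N).symm = ν.withDensity fun z => ‖c z‖ₑ ^ 2)
    (hS : Measure.QuasiMeasurePreserving (shift N) ν ν) :
    ∃ ρ : BaumslagSolitar N →* (Lp ℂ 2 ν ≃ₗᵢ[ℂ] Lp ℂ 2 ν),
      (∀ ξ, ρ (BaumslagSolitar.u N) ξ =ᵐ[ν] fun z => c z * ξ (shift N z)) ∧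
      ∀ ξ, ρ (BaumslagSolitar.t N) ξ =ᵐ[ν] fun z => (z.1 0 : ℂ) * ξ z := by
  obtain ⟨U, hU⟩ := exists_linearIsometryEquiv_mul_comp (shiftEquiv N) hc hc0 h
  obtain ⟨T, hT⟩ := exists_solenoid_mul_coord (ν := ν) 0
  have hrel : U * T * U⁻¹ = T ^ N := by
    rw [mul_inv_eq_iff_eq_mul]
    refine LinearIsometryEquiv.ext fun ξ => Lp.ext ?_
    change U (T ξ) =ᵐ[ν] (T ^ N) (U ξ)
    have hTN := zpow_ae_eq_mul (c := fun z : Solenoid N => z.1 0) hT N (U ξ)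
    rw [zpow_natCast] at hTN
    filter_upwards [hU (T ξ), hU ξ, hS.ae (hT ξ), hTN] with z h1 h2 h3 h4
    rw [h1, h4, h2]
    change c z * T ξ (shift N z) = _ * (c z * ξ (shift N z))
    rw [h3, shift_zero, zpow_natCast, mul_left_comm]
  obtain ⟨ρ, hu, ht⟩ := BaumslagSolitar.exists_monoidHom N hrel
  exact ⟨ρ, fun ξ => by rw [hu]; exact hU ξ, fun ξ => by rw [ht]; exact hT ξ⟩

/-- The conjugates `u⁻ⁿ t^k uⁿ` act as multiplication by the characters of the solenoid. -/
theorem conj_apply_ae_eq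
    (hu : ∀ ξ, ρ (BaumslagSolitar.u N) ξ =ᵐ[ν] fun z => c z * ξ (shift N z))
    (ht : ∀ ξ, ρ (BaumslagSolitar.t N) ξ =ᵐ[ν] fun z => (z.1 0 : ℂ) * ξ z)
    (hS : Measure.QuasiMeasurePreserving (shift N) ν ν) (n : ℕ) (k : ℤ) (ξ : Lp ℂ 2 ν) :
    ρ ((BaumslagSolitar.u N ^ n)⁻¹ * BaumslagSolitar.t N ^ k * BaumslagSolitar.u N ^ n) ξ =ᵐ[ν]
      fun z => ((z.1 n ^ k : Circle) : ℂ) * ξ z := by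
  induction n generalizing ξ with
  | zero =>
    have := zpow_ae_eq_mul (c := fun z : Solenoid N => z.1 0) ht k ξ
    rw [← map_zpow] at this
    simpa using this
  | succ n ih =>
    obtain ⟨M, hM⟩ := exists_solenoid_mul_coord (ν := ν) (n + 1)
    set g := (BaumslagSolitar.u N ^ n)⁻¹ * BaumslagSolitar.t N ^ k * BaumslagSolitar.u N ^ n
    have hg : (BaumslagSolitar.u N ^ (n + 1))⁻¹ * BaumslagSolitar.t N ^ k *
        BaumslagSolitar.u N ^ (n + 1) = (BaumslagSolitar.u N)⁻¹ * (g * BaumslagSolitar.u N) := by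
      simp only [g, pow_succ, mul_inv_rev, mul_assoc]
    have hMk := zpow_ae_eq_mul (c := fun z : Solenoid N => z.1 (n + 1)) hM k ξ
    -- As (S z)_{n+1} = z_n, conjugating by u⁻¹ turns the symbol z_n^k into z_{n+1}^k.
    have key : ρ (BaumslagSolitar.u N) ((M ^ k) ξ) = ρ g (ρ (BaumslagSolitar.u N) ξ) := by
      refine Lp.ext ?_
      filter_upwards [hu ((M ^ k) ξ), ih (ρ (BaumslagSolitar.u N) ξ), hu ξ, hS.ae hMk]
        with z h1 h2 h3 h4
      rw [h1, h2, h3, h4, shift_succ, mul_left_comm]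
    have : ρ ((BaumslagSolitar.u N)⁻¹ * (g * BaumslagSolitar.u N)) ξ = (M ^ k) ξ := by
      rw [map_mul, map_mul, map_inv]
      change (ρ (BaumslagSolitar.u N)).symm (ρ g (ρ (BaumslagSolitar.u N) ξ)) = _
      rw [← key, LinearIsometryEquiv.symm_apply_apply]
    rw [hg, this]
    exact hMk

theorem Lp.const_one_coeFn {X : Type*} [MeasurableSpace X] (ν : Measure X) [IsFiniteMeasure ν] :
    Lp.const 2 ν (1 : ℂ) =ᵐ[ν] fun _ => 1 := Lp.coeFn_const 2 ν 1

variable [IsFiniteMeasure ν]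

theorem toLp_solenoidCharacter_eq
    (hu : ∀ ξ, ρ (BaumslagSolitar.u N) ξ =ᵐ[ν] fun z => c z * ξ (shift N z))
    (ht : ∀ ξ, ρ (BaumslagSolitar.t N) ξ =ᵐ[ν] fun z => (z.1 0 : ℂ) * ξ z)
    (hS : Measure.QuasiMeasurePreserving (shift N) ν ν) (p : ℕ × ℤ) :
    ContinuousMap.toLp 2 ν ℂ (solenoidCharacter N p) =
      ρ ((BaumslagSolitar.u N ^ p.1)⁻¹ * BaumslagSolitar.t N ^ p.2 * BaumslagSolitar.u N ^ p.1)
        (Lp.const 2 ν 1) := by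
  refine Lp.ext ?_
  filter_upwards [ContinuousMap.coeFn_toLp (p := 2) (𝕜 := ℂ) ν (solenoidCharacter N p),
    conj_apply_ae_eq hu ht hS p.1 p.2 (Lp.const 2 ν 1), Lp.const_one_coeFn ν] with z h1 h2 h3
  rw [h1, h2, h3, mul_one, solenoidCharacter_apply]

/-- An operator A in the commutant commutes with multiplication by each character χ, so Aχ = χ · A1.
Hence A is multiplication by F = A1, which is bounded because A is. Evaluating AU = UA at 1 gives F
· c = c · (F ∘ S), and c cancels. -/
theorem commutant_eq_mul (hc0 : ∀ᵐ z ∂ν, c z ≠ 0)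
    (hu : ∀ ξ, ρ (BaumslagSolitar.u N) ξ =ᵐ[ν] fun z => c z * ξ (shift N z))
    (ht : ∀ ξ, ρ (BaumslagSolitar.t N) ξ =ᵐ[ν] fun z => (z.1 0 : ℂ) * ξ z)
    (hS : Measure.QuasiMeasurePreserving (shift N) ν ν) :
    commutant ρ = {A | ∃ f : Solenoid N → ℂ, MemLp f ∞ ν ∧
        (fun z => f (shift N z)) =ᵐ[ν] f ∧ IsMultiplication f A} := by
  ext A
  constructor
  · intro hA
    set F := A (Lp.const 2 ν 1)
    have hmul : ∀ ξ : Lp ℂ 2 ν, A ξ =ᵐ[ν] fun z => F z * ξ z := by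
      refine ae_eq_mul_of_dense_span A F (dense_span_solenoidCharacter ν) ?_
      rintro _ ⟨p, rfl⟩
      have e := toLp_solenoidCharacter_eq hu ht hS p
      simp only [e]
      rw [hA]
      filter_upwards [conj_apply_ae_eq hu ht hS p.1 p.2 F,
        conj_apply_ae_eq hu ht hS p.1 p.2 (Lp.const 2 ν 1), Lp.const_one_coeFn ν] with z h1 h2 h3
      rw [h1, h2, h3, mul_one, mul_comm]
    refine ⟨F, memLp_top_of_continuousLinearMap_mul A (Lp.aestronglyMeasurable F) hmul, ?_, hmul⟩
    have h1 := hmul (ρ (BaumslagSolitar.u N) (Lp.const 2 ν 1))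
    rw [hA] at h1
    filter_upwards [h1, hu (Lp.const 2 ν 1), hu F, hS.ae (Lp.const_one_coeFn ν), hc0]
      with z e1 e2 e3 e4 e5
    rw [e3, e2, e4, mul_one, mul_comm] at e1
    exact mul_right_cancel₀ e5 e1
  · rintro ⟨f, -, hfS, hA⟩
    have hmem : ∀ g ∈ Subgroup.closure {BaumslagSolitar.u N, BaumslagSolitar.t N},
        ∀ v, A (ρ g v) = ρ g (A v) := by
      intro g hg
      induction hg using Subgroup.closure_induction with
      | mem g hg =>
        intro v
        refine Lp.ext ?_
        rcases hg with rfl | rfl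
        · filter_upwards [hA (ρ (BaumslagSolitar.u N) v), hu v, hu (A v), hS.ae (hA v), hfS]
            with z e1 e2 e3 e4 e5
          rw [e1, e2, e3, e4, e5, mul_left_comm]
        · filter_upwards [hA (ρ (BaumslagSolitar.t N) v), ht v, ht (A v), hA v] with z e1 e2 e3 e4
          rw [e1, e2, e3, e4, mul_left_comm]
      | one => intro v; simp
      | mul g g' _ _ h1 h2 =>
        intro v
        rw [map_mul]
        change A (ρ g (ρ g' v)) = ρ g (ρ g' (A v))
        rw [h1, h2]
      | inv g _ h1 =>
        intro v
        rw [map_inv]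
        change A ((ρ g).symm v) = (ρ g).symm (A v)
        rw [LinearIsometryEquiv.eq_symm_apply, ← h1, LinearIsometryEquiv.apply_symm_apply]
    exact fun g v => hmem g (BaumslagSolitar.closure_eq_top N ▸ Subgroup.mem_top g) v

/-- The spectral measures of multiplication by `z_0` on `L²` of the solenoid. -/
theorem exists_isCorrelation_mul_coord
    (hp : MeasurePreserving (fun z : Solenoid N => z.1 0) ν circleMeasure)
    {T : Lp ℂ 2 ν ≃ₗᵢ[ℂ] Lp ℂ 2 ν} (hT : ∀ ξ, T ξ =ᵐ[ν] fun z => (z.1 0 : ℂ) * ξ z)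
    (v w : Lp ℂ 2 ν) :
    ∃ h : Circle → ℂ, IsCorrelation T v w h ∧ ∀ f : Circle → ℂ, MemLp f ∞ circleMeasure →
      ∫ z, f (z.1 0) * (v z * (starRingEnd ℂ) (w z)) ∂ν = ∫ z, f z * h z ∂circleMeasure := by
  have hg : Integrable (fun z => v z * (starRingEnd ℂ) (w z)) ν :=
    (L2.integrable_inner (𝕜 := ℂ) w v).congr
      (Filter.Eventually.of_forall fun z => RCLike.inner_apply _ _)
  obtain ⟨h, hint, hf⟩ := exists_integrable_density_of_map hp hg
  refine ⟨h, ⟨hint, fun k => ?_⟩, hf⟩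
  have hk : MemLp (circleCharacter k) ∞ circleMeasure :=
    memLp_top_of_bound (circleCharacter k).continuous.aestronglyMeasurable 1
      (Filter.Eventually.of_forall fun z => (Circle.norm_coe _).le)
  refine Eq.trans ?_ (hf _ hk)
  rw [Lp.inner_eq_integral_mul_conj]
  refine integral_congr_ae ?_
  filter_upwards [zpow_ae_eq_mul (c := fun z : Solenoid N => z.1 0) hT k v] with z hz
  rw [hz, mul_assoc]

theorem isBorelCalculus_of_mul
    (hp : MeasurePreserving (fun z : Solenoid N => z.1 0) ν circleMeasure)
    {T : Lp ℂ 2 ν ≃ₗᵢ[ℂ] Lp ℂ 2 ν} (hT : ∀ ξ, T ξ =ᵐ[ν] fun z => (z.1 0 : ℂ) * ξ z)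
    {f : Circle → ℂ} (hf : MemLp f ∞ circleMeasure) {A : Lp ℂ 2 ν →L[ℂ] Lp ℂ 2 ν}
    (hA : IsMultiplication (fun z => f (z.1 0)) A) : IsBorelCalculus T f A := by
  intro v w h hh
  obtain ⟨h', hh', hf'⟩ := exists_isCorrelation_mul_coord hp hT v w
  have e1 : ∫ z, f z * h z ∂circleMeasure = ∫ z, f z * h' z ∂circleMeasure := by
    refine integral_congr_ae ?_
    filter_upwards [hh.ae_eq hh'] with z hz
    rw [hz]
  rw [e1, ← hf' f hf, Lp.inner_eq_integral_mul_conj]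
  refine integral_congr_ae ?_
  filter_upwards [hA v] with z hz
  rw [hz, mul_assoc]

theorem isWaveletRepresentation_const {m₀ : Circle → ℂ} (hm₀ : MemLp m₀ ∞ circleMeasure)
    (hp : MeasurePreserving (fun z : Solenoid N => z.1 0) ν circleMeasure)
    (hu : ∀ ξ, ρ (BaumslagSolitar.u N) ξ =ᵐ[ν] fun z => m₀ (z.1 0) * ξ (shift N z))
    (ht : ∀ ξ, ρ (BaumslagSolitar.t N) ξ =ᵐ[ν] fun z => (z.1 0 : ℂ) * ξ z)
    (hS : Measure.QuasiMeasurePreserving (shift N) ν ν) :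
    IsWaveletRepresentation N m₀ (fun _ => 1) ρ (Lp.const 2 ν (1 : ℂ)) := by
  refine ⟨fun v w => ?_, ?_, ?_, integrable_const _, fun k => ?_⟩
  · obtain ⟨h, hh, -⟩ := exists_isCorrelation_mul_coord hp ht v w
    exact ⟨h, hh⟩
  · obtain ⟨A, hA⟩ := exists_continuousLinearMap_mul (hm₀.comp_measurePreserving hp)
    refine ⟨A, isBorelCalculus_of_mul hp ht hm₀ hA, Lp.ext ?_⟩
    filter_upwards [hu (Lp.const 2 ν 1), hA (Lp.const 2 ν 1), Lp.const_one_coeFn ν,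
      hS.ae (Lp.const_one_coeFn ν)] with z h1 h2 h3 h4
    rw [h1, h2, h3, h4]
    rfl
  · refine (dense_span_solenoidCharacter ν).mono (Submodule.span_mono ?_)
    rintro _ ⟨p, rfl⟩
    exact ⟨_, (toLp_solenoidCharacter_eq hu ht hS p).symm⟩
  -- The correlation function of 1 is the density of the law of z_0, which is μ itself.
  · have hk : AEStronglyMeasurable (fun z : Circle => ((z ^ k : Circle) : ℂ) * 1) circleMeasure :=
      ((circleCharacter k).continuous.mul continuous_const).aestronglyMeasurable
    rw [Lp.inner_eq_integral_mul_conj, ← hp.map_eq, integral_map hp.measurable.aemeasurable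
      (hp.map_eq.symm ▸ hk)]
    refine integral_congr_ae ?_
    filter_upwards [zpow_ae_eq_mul (c := fun z : Solenoid N => z.1 0) ht k (Lp.const 2 ν 1),
      Lp.const_one_coeFn ν] with z h1 h2
    rw [h1, h2, map_one, mul_one]

end Solenoid

/-! ## The filter representation -/

section FilterRepresentation

variable {N : ℕ} [NeZero N] {m₀ : Circle → ℂ}

theorem aestronglyMeasurable_comp_coord_zero (hm : AEStronglyMeasurable m₀ circleMeasure)
    (hR : ruelle N m₀ (fun _ => 1) =ᵐ[circleMeasure] fun _ => 1) :
    AEStronglyMeasurable (fun z : Solenoid N => m₀ (z.1 0)) (filterMeasure N m₀) :=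
  hm.comp_measurePreserving (measurePreserving_coord_zero hm hR)

theorem ae_comp_coord_zero_ne_zero (hm : AEStronglyMeasurable m₀ circleMeasure)
    (hns : ∀ᵐ z ∂circleMeasure, m₀ z ≠ 0)
    (hR : ruelle N m₀ (fun _ => 1) =ᵐ[circleMeasure] fun _ => 1) :
    ∀ᵐ z ∂filterMeasure N m₀, m₀ (z.1 0) ≠ 0 :=
  (measurePreserving_coord_zero hm hR).quasiMeasurePreserving.ae (p := fun z => m₀ z ≠ 0) hns

theorem map_shift_withDensity (hm : AEStronglyMeasurable m₀ circleMeasure)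
    (hR : ruelle N m₀ (fun _ => 1) =ᵐ[circleMeasure] fun _ => 1) :
    ((filterMeasure N m₀).withDensity fun z => ‖m₀ (z.1 0)‖ₑ ^ 2).map (shift N) =
      filterMeasure N m₀ := by
  rw [← filterMeasure_map_shift_symm hm hR, Measure.map_map (measurable_shift N)
    (measurable_shift_symm N)]
  simp

/-- The dual form of `R 1 = 1`. -/
theorem map_pow_withDensity (hm : AEStronglyMeasurable m₀ circleMeasure)
    (hR : ruelle N m₀ (fun _ => 1) =ᵐ[circleMeasure] fun _ => 1) :
    (circleMeasure.withDensity fun z => ‖m₀ z‖ₑ ^ 2).map (fun z : Circle => z ^ N) =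
      circleMeasure := by
  obtain ⟨w, hw, hmw⟩ := id hm
  -- |m₀|²μ is the law of z_1, and z_1^N = z_0 has law μ.
  have h1 : circleMeasure.withDensity (fun z => ‖m₀ z‖ₑ ^ 2) =
      (filterMeasure N m₀).map fun z => z.1 1 := by
    rw [filterMeasure_map_coord hm hR hw.measurable hmw 1]
    refine withDensity_congr_ae ?_
    filter_upwards [hmw] with z hz
    simp [filterDensity, hz]
  rw [h1, Measure.map_map (continuous_pow N).measurable (Solenoid.measurable_coord N 1),
    ← (measurePreserving_coord_zero hm hR).map_eq]
  congr 1
  ext z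
  exact congrArg _ (z.2 0)

theorem sqrt_rnDeriv_mul_filterPhase (hm : AEStronglyMeasurable m₀ circleMeasure)
    (hR : ruelle N m₀ (fun _ => 1) =ᵐ[circleMeasure] fun _ => 1) :
    ∀ᵐ z ∂filterMeasure N m₀,
      ((Real.sqrt ((measureCompShift (filterMeasure N m₀)).rnDeriv
        (filterMeasure N m₀) z).toReal : ℝ) : ℂ) * filterPhase N m₀ z = m₀ (z.1 0) := by
  rw [measureCompShift, filterMeasure_map_shift_symm hm hR]
  have h := Measure.rnDeriv_withDensity₀ (filterMeasure N m₀)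
    ((aestronglyMeasurable_comp_coord_zero hm hR).enorm.pow_const 2)
  filter_upwards [h] with z hz
  rw [hz, ← ofReal_norm, ← ENNReal.ofReal_pow (norm_nonneg _),
    ENNReal.toReal_ofReal (by positivity), Real.sqrt_sq (norm_nonneg _), filterPhase]
  -- Where m₀ vanishes, so does √Δ, and the value of the quotient in `filterPhase` is irrelevant.
  by_cases h0 : m₀ (z.1 0) = 0
  · simp [h0]
  · rw [mul_div_cancel₀]
    simpa using h0

theorem isSolenoidRepresentation_filterMeasure (hm : AEStronglyMeasurable m₀ circleMeasure)
    (hns : ∀ᵐ z ∂circleMeasure, m₀ z ≠ 0)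
    (hR : ruelle N m₀ (fun _ => 1) =ᵐ[circleMeasure] fun _ => 1)
    {ρ : BaumslagSolitar N →* (Lp ℂ 2 (filterMeasure N m₀) ≃ₗᵢ[ℂ] Lp ℂ 2 (filterMeasure N m₀))}
    (hu : ∀ ξ, ρ (BaumslagSolitar.u N) ξ =ᵐ[filterMeasure N m₀]
      fun z => m₀ (z.1 0) * ξ (shift N z))
    (ht : ∀ ξ, ρ (BaumslagSolitar.t N) ξ =ᵐ[filterMeasure N m₀] fun z => (z.1 0 : ℂ) * ξ z) :
    IsSolenoidRepresentation (filterMeasure N m₀) (filterPhase N m₀) ρ := by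
  have hc := aestronglyMeasurable_comp_coord_zero hm hR
  have hc0 := ae_comp_coord_zero_ne_zero hm hns hR
  refine ⟨inferInstance, ?_, ?_, ?_, ?_, fun ξ => ?_, ht⟩
  · rw [measureCompShift, filterMeasure_map_shift_symm hm hR]
    exact withDensity_absolutelyContinuous _ _
  · rw [measureCompShift, filterMeasure_map_shift_symm hm hR]
    refine withDensity_absolutelyContinuous' (hc.enorm.pow_const 2) ?_
    filter_upwards [hc0] with z hz
    simpa using hz
  · exact (hc.aemeasurable.div
      (Complex.measurable_ofReal.comp_aemeasurable hc.norm.aemeasurable)).aestronglyMeasurable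
  · filter_upwards [hc0] with z hz
    simp [filterPhase, hz]
  · filter_upwards [hu ξ, sqrt_rnDeriv_mul_filterPhase hm hR] with z h1 h2
    rw [h1, h2]

end FilterRepresentation

end

theorem theorem3p3 (N : ℕ) [NeZero N] (hN : 2 ≤ N) (m₀ : Circle → ℂ)
    (hm₀ : MemLp m₀ ∞ circleMeasure)
    (hns : ∀ᵐ z ∂circleMeasure, m₀ z ≠ 0)
    (hR : ruelle N m₀ (fun _ => 1) =ᵐ[circleMeasure] fun _ => 1) :
    -- the measures `P_x` satisfy the cylinder formula of the random walk for almost every `x`,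
    -- and `m` is the probability measure on the solenoid that they define
    ((∀ᵐ x ∂((volume : Measure ℝ).restrict (Set.Ico 0 1)), ∀ (n : ℕ) (a : ℕ → Fin N),
        walkMeasure N (filterWeight N m₀) x {ω | ∀ i < n, ω i = a i} =
          ENNReal.ofReal
            (∏ i ∈ Finset.range n, filterWeight N m₀ (circleParam (walkPos N x a (i + 1))))) ∧
      IsProbabilityMeasure (filterMeasure N m₀) ∧
      ∀ E : Set (Solenoid N), MeasurableSet E →
        filterMeasure N m₀ E =
          ∫⁻ x in Set.Ico (0 : ℝ) 1, walkMeasure N (filterWeight N m₀) x {ω | solenoidPath N x ω ∈ E}) ∧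
    ∃ ρ : BaumslagSolitar N →* (Lp ℂ 2 (filterMeasure N m₀) ≃ₗᵢ[ℂ] Lp ℂ 2 (filterMeasure N m₀)),
      -- `ρ` is the representation associated to `m` and `θ`
      IsSolenoidRepresentation (filterMeasure N m₀) (filterPhase N m₀) ρ ∧
      -- `U ξ = m₀ · ξ ∘ S`
      (∀ ξ : Lp ℂ 2 (filterMeasure N m₀),
        ρ (BaumslagSolitar.u N) ξ =ᵐ[filterMeasure N m₀] fun z => m₀ (z.1 0) * ξ (shift N z)) ∧
      -- `π(f) = f(T)` is multiplication by `f`, for `f ∈ L^∞(𝕋)`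
      (∀ f : Circle → ℂ, MemLp f ∞ circleMeasure →
        ∃ A : Lp ℂ 2 (filterMeasure N m₀) →L[ℂ] Lp ℂ 2 (filterMeasure N m₀),
          IsBorelCalculus (ρ (BaumslagSolitar.t N)) f A ∧
          IsMultiplication (fun z => f (z.1 0)) A) ∧
      -- with `φ = 1`, it is a wavelet representation associated to `m₀` and `h = 1`
      IsWaveletRepresentation N m₀ (fun _ => 1) ρ (Lp.const 2 (filterMeasure N m₀) (1 : ℂ)) ∧
      -- and every such wavelet representation is isomorphic to it
      (∀ (H : Type*) [NormedAddCommGroup H] [InnerProductSpace ℂ H] [CompleteSpace H]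
        (ρ' : BaumslagSolitar N →* (H ≃ₗᵢ[ℂ] H)) (φ' : H),
        IsWaveletRepresentation N m₀ (fun _ => 1) ρ' φ' →
        ∃ V : H ≃ₗᵢ[ℂ] Lp ℂ 2 (filterMeasure N m₀),
          V φ' = Lp.const 2 (filterMeasure N m₀) (1 : ℂ) ∧
          ∀ g v, V (ρ' g v) = ρ g (V v)) ∧
      -- the commutant consists of the multiplications by `S`-invariant `L^∞` functions
      commutant ρ = {A | ∃ f : Solenoid N → ℂ, MemLp f ∞ (filterMeasure N m₀) ∧
        (fun z => f (shift N z)) =ᵐ[filterMeasure N m₀] f ∧ IsMultiplication f A} := by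
  have hm := hm₀.1
  have hc := aestronglyMeasurable_comp_coord_zero hm hR
  have hc0 := ae_comp_coord_zero_ne_zero hm hns hR
  have hp := measurePreserving_coord_zero hm hR
  have hS : Measure.QuasiMeasurePreserving (shift N) (filterMeasure N m₀) (filterMeasure N m₀) :=
    quasiMeasurePreserving_of_map_withDensity (measurable_shift N) hc hc0
      (map_shift_withDensity hm hR)
  refine ⟨⟨ae_walkMeasure_cylinder hR, isProbabilityMeasure_filterMeasure hm hR,
    fun E hE => filterMeasure_apply hm hR hE⟩, ?_⟩
  obtain ⟨ρ, hu, ht⟩ := exists_solenoid_representation hc hc0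
    (filterMeasure_map_shift_symm hm hR) hS
  have hwav := isWaveletRepresentation_const hm₀ hp hu ht hS
  refine ⟨ρ, isSolenoidRepresentation_filterMeasure hm hns hR hu ht, hu, fun f hf => ?_, hwav, ?_,
    commutant_eq_mul hc0 hu ht hS⟩
  · obtain ⟨A, hA⟩ := exists_continuousLinearMap_mul (hf.comp_measurePreserving hp)
    exact ⟨A, isBorelCalculus_of_mul hp ht hf hA, hA⟩
  · intro H _ _ _ ρ' φ' h'
    have hpow : Measurable fun z : Circle => z ^ N := (continuous_pow N).measurable
    -- R is f ↦ m₀ f(z^N) on L²(𝕋), the model of U on the closed span of the vectors T^k φ.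
    obtain ⟨R, hRop⟩ := exists_linearIsometry_mul_comp hpow hm hns (map_pow_withDensity hm hR)
    exact h'.exists_intertwiner hwav hRop
      (quasiMeasurePreserving_of_map_withDensity hpow hm hns (map_pow_withDensity hm hR))
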